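/- Let $\mathbb X$ be a measurable space with measurable diagonal, let $\mu$ be a $\sigma$-finite measure on $\mathbb X$, and let $H$ be a probability measure on $\mathbb X$ with $H(\{x\})=0$ for every $x$ and with a density $h\ge 0$ with respect to $\mu$. Let $\alpha,\tau>0$ and $\lambda(w)=\alpha w^{-1}e^{-\tau w}$ for $w>0$. Let $G\sim\Gamma(\alpha,\tau,H)$ be a gamma process, that is, $G=\sum_{j\ge1} w_j\delta_{X_j}$ almost surely, where the $X_j$ are i.i.d. with law $H$, the masses $(w_j)$ form a Poisson process on $(0,\infty)$ with intensity $\lambda(w)\,dw$, and $(X_j)$ is independent of $(w_j)$. Let $L\ge 0$ and $m_1,\dots,m_L\ge 0$ be integers. Conditionally on $G$, let the pairs $(Y_\ell,Z_\ell)$, $1\le\ell\le L$, be independent, where $Y_\ell=(Y_{\ell1},\dots,Y_{\ell m_\ell})$ is a list of distinct items with $$P(Y_\ell=y\mid G)=\prod_{i=1}^{m_\ell}\frac{G(\{y_i\})}{G(\mathbb X\setminus\{y_1,\dots,y_{i-1}\})},$$ and, given $G$ and $Y_\ell$, the auxiliary variables $Z_{\ell1},\dots,Z_{\ell m_\ell}$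 are independent with $Z_{\ell i}$ exponentially distributed with rate $G(\mathbb X\setminus\{Y_{\ell1},\dots,Y_{\ell\,i-1}\})$. For data $(Y_\ell,Z_\ell)_{\ell=1}^L$ let $X^*_1,\dots,X^*_K$ be the distinct items among all the lists, let $n_k$ be the number of pairs $(\ell,i)$ with $Y_{\ell i}=X^*_k$, and let $\delta_{\ell ik}=0$ if $Y_{\ell j}=X^*_k$ for some $j<i$, and $\delta_{\ell ik}=1$ otherwise. Let the reference measure on the data be the sum, over all partitions of the set of positions $\{(\ell,i)\}$ in which two different positions of the same list never share a block, of the measure that puts one item in each block, integrates the $K$ items of the blocks, restricted to be pairwise distinct, with respect to $\mu(dx_1)\cdots\mu(dx_K)$, and integrates the auxiliary variables with respect to Lebesgue measure on $(0,\infty)$ in each coordinate. Then the joint law of $(Y_\ell,Z_\ell)_{\ell=1}^L$ has, with respect to this reference measure, the density $$P\big((Y_\ell,Z_\ell)_{\ell=1}^L\big)=e^{-\psi\left(\sum_{\ell i}Z_{\ell i}\right)}\prod_{k=1}^K h(X^*_k)\,\kappa\Big(n_k,\sum_{\ell i}\delta_{\ell ik}Z_{\ell i}\Big).$$ Here, for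 $z\ge0$, $$\psi(z)=-\log\mathbb E\big[e^{-zG(\mathbb X)}\big]=\int_0^\infty\lambda(w)(1-e^{-zw})\,dw=\alpha\log\Big(1+\frac z\tau\Big),$$ where $G(\mathbb X)<\infty$ almost surely, and, for integers $n\ge1$ and $z\ge0$, $$\kappa(n,z)=\int_0^\infty\lambda(w)w^ne^{-zw}\,dw=\frac{\alpha}{(z+\tau)^n}\Gamma(n),$$ all these integrals being finite. -/

import Mathlib

open MeasureTheory ProbabilityTheory Set
open scoped ENNReal NNReal

namespace PlackettLuce

noncomputable section

/-- The Lévy intensity `λ(w) = α w⁻¹ e^{-τ w}` of the gamma process (used for `w > 0`). -/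
def levyIntensity (α τ w : ℝ) : ℝ := α * w⁻¹ * Real.exp (-(τ * w))

/-- The measure `λ(w) dw` on the half line `(0, ∞)`. -/
def levyMeasure (α τ : ℝ) : Measure ℝ :=
  (volume.restrict (Ioi 0)).withDensity fun w => ENNReal.ofReal (levyIntensity α τ w)

/-- The Laplace exponent `ψ(z) = ∫₀^∞ λ(w) (1 - e^{-z w}) dw`. -/
def laplaceExponent (α τ z : ℝ) : ℝ :=
  ∫ w in Ioi (0 : ℝ), levyIntensity α τ w * (1 - Real.exp (-(z * w)))

/-- The `n`-th moment `κ(n, z) = ∫₀^∞ λ(w) wⁿ e^{-z w} dw` of the exponentially tilted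
Lévy intensity. -/
def tiltedMoment (α τ : ℝ) (n : ℕ) (z : ℝ) : ℝ :=
  ∫ w in Ioi (0 : ℝ), levyIntensity α τ w * w ^ n * Real.exp (-(z * w))

/-- The Poisson law with mean `r ∈ [0, ∞]`; for `r = ∞` it is the point mass at `∞`. -/
def poissonLaw (r : ℝ≥0∞) : Measure ℝ≥0∞ :=
  if r = ∞ then Measure.dirac ∞
  else (poissonMeasure r.toNNReal).map (Nat.cast : ℕ → ℝ≥0∞)

/-- The number of points of the sequence `w` that lie in `A`, as an element of `[0, ∞]`. -/
def pointCount {E : Type*} [MeasurableSpace E] (w : ℕ → E) (A : Set E) : ℝ≥0∞ :=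
  Measure.sum (fun j => Measure.dirac (w j)) A

/-- The random points `w 0, w 1, …` form a Poisson process with intensity measure `ν`: the number
of points in a measurable set `A` has the Poisson law with mean `ν A`, and the numbers of points
in finitely many disjoint measurable sets are independent. -/
structure IsPoissonProcess {Ω E : Type*} [MeasurableSpace Ω] [MeasurableSpace E]
    (P : Measure Ω) (ν : Measure E) (w : ℕ → Ω → E) : Prop where
  measurable : ∀ j, Measurable (w j)
  count_law : ∀ A : Set E, MeasurableSet A →
    HasLaw (fun ω => pointCount (fun j => w j ω) A) (poissonLaw (ν A)) P
  count_indep : ∀ (n : ℕ) (A : Fin n → Set E), (∀ i, MeasurableSet (A i)) →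
    Pairwise (fun i j => Disjoint (A i) (A j)) →
    iIndepFun (fun i ω => pointCount (fun j => w j ω) (A i)) P

/-- `G ∼ Γ(α, τ, H)`: the random measure `G` is almost surely `∑ⱼ wⱼ δ_{Xⱼ}`, where the locations
`Xⱼ` are i.i.d. with law `H`, the masses `wⱼ` form a Poisson process on `(0, ∞)` with intensity
`λ(w) dw`, and the sequence of locations is independent of the sequence of masses. -/
def IsGammaProcess {Ω 𝕏 : Type*} [MeasurableSpace Ω] [MeasurableSpace 𝕏]
    (P : Measure Ω) (α τ : ℝ) (H : Measure 𝕏) (G : Ω → Measure 𝕏) : Prop :=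
  Measurable G ∧
  ∃ (w : ℕ → Ω → ℝ) (X : ℕ → Ω → 𝕏),
    IsPoissonProcess P (levyMeasure α τ) w ∧
    (∀ j, Measurable (X j)) ∧
    (∀ j, HasLaw (X j) H P) ∧
    iIndepFun X P ∧
    IndepFun (fun ω j => X j ω) (fun ω j => w j ω) P ∧
    ∀ᵐ ω ∂P, G ω = Measure.sum fun j => ENNReal.ofReal (w j ω) • Measure.dirac (X j ω)

/-- The mass `G(𝕏 \ {y₁, …, y_{i-1}})` of the items that are still available at stage `i`. -/
def remainingMass {𝕏 : Type*} [MeasurableSpace 𝕏] (G : Measure 𝕏) {m : ℕ} (y : Fin m → 𝕏)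
    (i : Fin m) : ℝ≥0∞ :=
  G {x | ∀ j, j < i → x ≠ y j}

open Classical in
/-- The Plackett–Luce probability `∏ᵢ G({yᵢ}) / G(𝕏 \ {y₁, …, y_{i-1}})` of the top-`m` list `y`
given `G`. Items are drawn without replacement, so a list that repeats an item has
probability zero. -/
def rankingProb {𝕏 : Type*} [MeasurableSpace 𝕏] (G : Measure 𝕏) {m : ℕ} (y : Fin m → 𝕏) : ℝ≥0∞ :=
  if Function.Injective y then ∏ i, G {y i} / remainingMass G y i else 0

/-- The conditional law, given `G`, of a top-`m` list together with its auxiliary variables: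
the list is `y` with probability `rankingProb G y`, and given `G` and the list `y` the auxiliary
variables `z₁, …, z_m` are independent, `zᵢ` being exponential with rate
`G(𝕏 \ {y₁, …, y_{i-1}})`. -/
def rankingLaw {𝕏 : Type*} [MeasurableSpace 𝕏] (G : Measure 𝕏) (m : ℕ) :
    Measure ((Fin m → 𝕏) × (Fin m → ℝ)) :=
  Measure.sum fun y : Fin m → 𝕏 =>
    rankingProb G y •
      (Measure.dirac y).prod (Measure.pi fun i => expMeasure (remainingMass G y i).toReal)

/-- The data: for each `ℓ`, a list of `m ℓ` items and as many real auxiliary variables. -/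
abbrev RankingData (𝕏 : Type*) {L : ℕ} (m : Fin L → ℕ) : Type _ :=
  (ℓ : Fin L) → (Fin (m ℓ) → 𝕏) × (Fin (m ℓ) → ℝ)

/-- The observations `D ω = (Y_ℓ, Z_ℓ)_ℓ` are, conditionally on `G`, independent over `ℓ` with
the Plackett–Luce laws `rankingLaw G (m ℓ)`: this product is the conditional distribution of `D`
given `G`. -/
def IsPlackettLuceSample {Ω 𝕏 : Type*} [MeasurableSpace Ω] [MeasurableSpace 𝕏]
    (P : Measure Ω) (G : Ω → Measure 𝕏) {L : ℕ} (m : Fin L → ℕ) (D : Ω → RankingData 𝕏 m) : Prop :=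
  Measurable D ∧
  ∀ (A : Set (Measure 𝕏)) (S : Set (RankingData 𝕏 m)), MeasurableSet A → MeasurableSet S →
    P (G ⁻¹' A ∩ D ⁻¹' S) = ∫⁻ ω in G ⁻¹' A, Measure.pi (fun ℓ => rankingLaw (G ω) (m ℓ)) S ∂P

/-- The positions `(ℓ, i)`. -/
abbrev Position {L : ℕ} (m : Fin L → ℕ) : Type := Σ ℓ : Fin L, Fin (m ℓ)

/-- A pattern of ties: which positions hold the same item. Positions in the same list
hold different items. -/
def TiePattern {L : ℕ} (m : Fin L → ℕ) : Type :=
  {s : Setoid (Position m) //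
    ∀ (ℓ : Fin L) (i j : Fin (m ℓ)), s.r (⟨ℓ, i⟩ : Position m) ⟨ℓ, j⟩ → i = j}

/-- The data with tie pattern `s`, one item `x k` for each class `k` of `s`, and auxiliary
variables `z`. -/
def assemble {𝕏 : Type*} {L : ℕ} {m : Fin L → ℕ} (s : TiePattern m)
    (p : (Quotient s.1 → 𝕏) × (Position m → ℝ)) : RankingData 𝕏 m :=
  fun ℓ => (fun i => p.1 (Quotient.mk s.1 ⟨ℓ, i⟩), fun i => p.2 ⟨ℓ, i⟩)

open Classical in
/-- The measure with respect to which the joint density is taken: for each pattern of ties, with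
`K` distinct items, it is `μ(dx₁) ⋯ μ(dx_K)` over the distinct items `x₁, …, x_K` times Lebesgue
measure on `(0, ∞)` for each auxiliary variable. -/
def referenceMeasure {𝕏 : Type*} [MeasurableSpace 𝕏] (μ : Measure 𝕏) {L : ℕ} (m : Fin L → ℕ) :
    Measure (RankingData 𝕏 m) :=
  Measure.sum fun s : TiePattern m =>
    (((Measure.pi fun _ : Quotient s.1 => μ).restrict {x | Function.Injective x}).prod
      (Measure.pi fun _ : Position m => (volume : Measure ℝ).restrict (Ioi 0))).map (assemble s)

open Classical in
/-- The set `{X*₁, …, X*_K}` of the distinct items that occur in the lists. -/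
def uniqueItems {𝕏 : Type*} {L : ℕ} {m : Fin L → ℕ} (d : RankingData 𝕏 m) : Finset 𝕏 :=
  Finset.univ.image fun p : Position m => (d p.1).1 p.2

open Classical in
/-- The number of occurrences of the item `x` in the lists. -/
def occurrences {𝕏 : Type*} {L : ℕ} {m : Fin L → ℕ} (d : RankingData 𝕏 m) (x : 𝕏) : ℕ :=
  (Finset.univ.filter fun p : Position m => (d p.1).1 p.2 = x).card

open Classical in
/-- The indicator `δ_{ℓ i}(x)`: it is `0` if `x` occurs in list `ℓ` before position `i`,
and `1` otherwise. -/
def occurrenceIndicator {𝕏 : Type*} {L : ℕ} {m : Fin L → ℕ} (d : RankingData 𝕏 m)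
    (ℓ : Fin L) (i : Fin (m ℓ)) (x : 𝕏) : ℝ :=
  if ∃ j, j < i ∧ (d ℓ).1 j = x then 0 else 1

/-- The function
`exp(-ψ(∑_{ℓ i} z_{ℓ i})) ∏ₖ h(X*ₖ) κ(nₖ, ∑_{ℓ i} δ_{ℓ i k} z_{ℓ i})` of the data. -/
def jointDensity {𝕏 : Type*} (α τ : ℝ) (h : 𝕏 → ℝ) {L : ℕ} {m : Fin L → ℕ}
    (d : RankingData 𝕏 m) : ℝ :=
  Real.exp (-laplaceExponent α τ (∑ ℓ, ∑ i, (d ℓ).2 i)) *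
    ∏ x ∈ uniqueItems d,
      h x * tiltedMoment α τ (occurrences d x)
        (∑ ℓ, ∑ i, occurrenceIndicator d ℓ i x * (d ℓ).2 i)

end

end PlackettLuce

/-! The auxiliary variables are chosen to cancel the denominators. If an item of mass `a` is drawn
while the remaining mass is `r`, then its probability `a / r` times the exponential density `r
e^{-rz}` is `a e^{-rz}` (`smul_expMeasure`). Since `r` is the sum of the masses of all atoms not yet
drawn, the conditional density given the atoms factorises over atoms: an observed atom of mass `w`
contributes `w^n e^{-w · exposure}`, where the exposure is the sum of the `z` of the stages at which
it was available, and an unobserved one contributes `e^{-w ∑ z}` (`prod_tiltedLebesgue_density`).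

The locations are almost surely distinct because `H` has no atoms. Hence lists of items are lists of
indices, and these amount to a tie pattern together with an injective choice of an index for each
class (`listsEquiv`, `pi_rankingLaw_atomicMeasure`). Locations and masses are independent. The
locations give `∏ h` on pairwise distinct tuples. Summing the mass factor over all index choices and
averaging is an instance of the multivariate Mecke formula
(`IsPoissonProcess.lintegral_tsum_embedding`) and gives `e^{-ψ} ∏ κ`.

The Mecke formula comes from the Laplace functional (`IsPoissonProcess.lintegral_negExp_tsum`) by
differentiating once per distinguished point. The derivative is a monotone limit of difference
quotients, and all values lie in `[0, ∞]`. The closed forms of `κ` and `ψ` are a gamma integral and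
a Frullani integral. -/

namespace PlackettLuce

/-! ### The exponential on `[0, ∞]` and the Poisson law. -/

/-- The decreasing exponential `x ↦ e^{-x}` on `[0, ∞]`. -/
noncomputable def negExp (x : ℝ≥0∞) : ℝ≥0∞ := EReal.exp (-(x : EReal))

@[simp] lemma negExp_zero : negExp 0 = 1 := by simp [negExp]

@[simp] lemma negExp_top : negExp ∞ = 0 := by simp [negExp]

lemma negExp_add (x y : ℝ≥0∞) : negExp (x + y) = negExp x * negExp y := by
  rw [negExp, negExp, negExp, ← EReal.exp_add, EReal.coe_ennreal_add,
    EReal.neg_add (by simp) (by simp), sub_eq_add_neg]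

lemma negExp_ofReal {x : ℝ} (hx : 0 ≤ x) :
    negExp (ENNReal.ofReal x) = ENNReal.ofReal (Real.exp (-x)) := by
  rw [negExp, EReal.coe_ennreal_ofReal, max_eq_left hx, ← EReal.coe_neg, EReal.exp_coe]

lemma continuous_negExp : Continuous negExp :=
  ENNReal.continuous_exp.comp (continuous_neg.comp continuous_coe_ennreal_ereal)

@[fun_prop]
lemma measurable_negExp : Measurable negExp := continuous_negExp.measurable

lemma antitone_negExp : Antitone negExp := fun _ _ hxy =>
  EReal.exp_monotone (EReal.neg_le_neg_iff.2 (EReal.coe_ennreal_le_coe_ennreal_iff.2 hxy))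

lemma negExp_le_one (x : ℝ≥0∞) : negExp x ≤ 1 := negExp_zero ▸ antitone_negExp zero_le

lemma negExp_ne_top (x : ℝ≥0∞) : negExp x ≠ ∞ := ((negExp_le_one x).trans_lt ENNReal.one_lt_top).ne

lemma negExp_ne_zero {x : ℝ≥0∞} (hx : x ≠ ∞) : negExp x ≠ 0 := by
  rw [← ENNReal.ofReal_toReal hx, negExp_ofReal ENNReal.toReal_nonneg]
  simpa using Real.exp_pos _

lemma negExp_lt_one {x : ℝ≥0∞} (hx : x ≠ 0) : negExp x < 1 := by
  rcases eq_or_ne x ∞ with rfl | h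
  · simp
  · rw [← ENNReal.ofReal_toReal h, negExp_ofReal ENNReal.toReal_nonneg, ← ENNReal.ofReal_one,
      ENNReal.ofReal_lt_ofReal_iff one_pos, Real.exp_lt_one_iff]
    simpa using ENNReal.toReal_pos hx h

lemma negExp_sum {ι : Type*} (s : Finset ι) (f : ι → ℝ≥0∞) :
    negExp (∑ i ∈ s, f i) = ∏ i ∈ s, negExp (f i) := by
  classical
  induction s using Finset.induction_on with
  | empty => simp
  | insert a s ha ih => rw [Finset.sum_insert ha, Finset.prod_insert ha, negExp_add, ih]

lemma negExp_mul_natCast (x : ℝ≥0∞) (n : ℕ) : negExp (x * n) = negExp x ^ n := by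
  induction n with
  | zero => simp
  | succ n ih => rw [Nat.cast_succ, mul_add, mul_one, negExp_add, ih, pow_succ]

/-- The Laplace transform of the Poisson law. -/
lemma lintegral_negExp_poissonLaw (r c : ℝ≥0∞) :
    ∫⁻ N, negExp (c * N) ∂poissonLaw r = negExp (r * (1 - negExp c)) := by
  rw [poissonLaw]
  split_ifs with hr
  · subst hr
    rw [lintegral_dirac' _ (by fun_prop)]
    -- For infinite mean both sides are `e^{-∞} = 0`, except at `c = 0`, where `0 · ∞ = 0` makes
    -- both equal to `1`.
    rcases eq_or_ne c 0 with rfl | hc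
    · simp
    · rw [ENNReal.mul_top hc, ENNReal.top_mul (tsub_pos_of_lt (negExp_lt_one hc)).ne']
  · lift r to ℝ≥0 using hr
    rw [lintegral_map (by fun_prop) (by fun_prop), lintegral_countable']
    simp_rw [negExp_mul_natCast, poissonMeasure_singleton, ENNReal.toNNReal_coe]
    obtain ⟨q, hq⟩ : ∃ q : ℝ≥0, negExp c = q := ⟨_, (ENNReal.coe_toNNReal (negExp_ne_top c)).symm⟩
    have hq1 : (q : ℝ) ≤ 1 := by exact_mod_cast hq ▸ negExp_le_one c
    have h2 : (r : ℝ≥0∞) * (1 - negExp c) = ENNReal.ofReal (r * (1 - q)) := by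
      rw [hq, ENNReal.ofReal_mul (by positivity), ENNReal.ofReal_sub _ (by positivity)]
      simp
    rw [h2, negExp_ofReal (by nlinarith [r.2])]
    have h3 : ∀ n : ℕ, negExp c ^ n * ENNReal.ofReal (Real.exp (-r) * r ^ n / n.factorial)
        = ENNReal.ofReal (Real.exp (-r) * ((r * q) ^ n / n.factorial)) := by
      intro n
      rw [hq, ← ENNReal.ofReal_coe_nnreal, ← ENNReal.ofReal_pow (by positivity),
        ← ENNReal.ofReal_mul (by positivity)]
      congr 1
      rw [mul_pow]; ring
    simp_rw [h3]
    have hs := (NormedSpace.expSeries_div_hasSum_exp (r * q : ℝ)).mul_left (Real.exp (-r))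
    rw [← ENNReal.ofReal_tsum_of_nonneg (fun n => by positivity) hs.summable, hs.tsum_eq,
      ← Real.exp_eq_exp_ℝ, ← Real.exp_add]
    congr 2; ring

lemma pointCount_eq_tsum {E : Type*} [MeasurableSpace E] (w : ℕ → E) {A : Set E}
    (hA : MeasurableSet A) : pointCount w A = ∑' j, A.indicator 1 (w j) := by
  simp [pointCount, Measure.sum_apply _ hA, Measure.dirac_apply' _ hA]

/-! ### The Laplace functional of a Poisson process. -/

section LaplaceFunctional

variable {Ω E : Type*} [MeasurableSpace Ω] [MeasurableSpace E] {P : Measure Ω} {ν : Measure E}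
  {w : ℕ → Ω → E}

lemma IsPoissonProcess.measurable_pointCount (hw : IsPoissonProcess P ν w) {A : Set E}
    (hA : MeasurableSet A) : Measurable fun ω => pointCount (fun j => w j ω) A := by
  simp_rw [pointCount_eq_tsum _ hA]
  exact Measurable.tsum fun j => (measurable_one.indicator hA).comp (hw.measurable j)

lemma IsPoissonProcess.lintegral_negExp_tsum_simpleFunc (hw : IsPoissonProcess P ν w)
    (φ : SimpleFunc E ℝ≥0∞) :
    ∫⁻ ω, negExp (∑' j, φ (w j ω)) ∂P = negExp (∫⁻ x, (1 - negExp (φ x)) ∂ν) := by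
  classical
  -- Points are grouped by the value of `φ`. The fibres are disjoint, so their counts are
  -- independent Poisson variables and the expectation factorises.
  have key : ∀ ω, negExp (∑' j, φ (w j ω))
      = ∏ c : φ.range, negExp (c.1 * pointCount (fun j => w j ω) (φ ⁻¹' {c.1})) := by
    intro ω
    rw [← negExp_sum]
    congr 1
    simp_rw [pointCount_eq_tsum _ (φ.measurableSet_fiber _), ← ENNReal.tsum_mul_left]
    rw [← Summable.tsum_finsetSum fun _ _ => ENNReal.summable]
    congr 1 with j
    rw [Finset.sum_eq_single ⟨φ (w j ω), φ.mem_range_self _⟩]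
    · simp
    · intro c _ hc
      have : w j ω ∉ φ ⁻¹' {c.1} := fun h => hc (Subtype.ext (by simpa using h.symm))
      simp [Set.indicator_of_notMem this]
    · simp
  have hind : iIndepFun (fun (c : φ.range) ω =>
      pointCount (fun j => w j ω) (φ ⁻¹' {c.1})) P := by
    have := hw.count_indep _ (fun i => φ ⁻¹' {(φ.range.equivFin.symm i).1})
      (fun i => φ.measurableSet_fiber _) ?_
    · have h2 := this.precomp φ.range.equivFin.injective
      simpa using h2
    · intro i j hij
      refine Set.disjoint_left.2 fun x hx hy => hij ?_
      apply φ.range.equivFin.symm.injective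
      apply Subtype.ext
      simp only [mem_preimage, mem_singleton_iff] at hx hy
      rw [← hx, ← hy]
  simp_rw [key]
  rw [lintegral_prod_eq_prod_lintegral_of_indepFun Finset.univ
    (fun (c : φ.range) ω => negExp (c.1 * pointCount (fun j => w j ω) (φ ⁻¹' {c.1})))
    (hind.comp (fun c x => negExp (c.1 * x)) (fun c => by fun_prop))
    (fun c => measurable_negExp.comp ((hw.measurable_pointCount
      (φ.measurableSet_fiber _)).const_mul _))]
  have h2 : ∀ c : φ.range, ∫⁻ ω, negExp (c.1 * pointCount (fun j => w j ω) (φ ⁻¹' {c.1})) ∂P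
      = negExp (ν (φ ⁻¹' {c.1}) * (1 - negExp c.1)) := by
    intro c
    rw [← lintegral_negExp_poissonLaw, ← (hw.count_law _ (φ.measurableSet_fiber _)).map_eq,
      lintegral_map (by fun_prop) (hw.measurable_pointCount (φ.measurableSet_fiber _))]
  simp_rw [h2]
  rw [← negExp_sum]
  congr 1
  have h3 := SimpleFunc.map_lintegral (μ := ν) (fun x => 1 - negExp x) φ
  rw [← SimpleFunc.lintegral_eq_lintegral] at h3
  simp only [SimpleFunc.map_apply] at h3
  rw [h3, ← Finset.sum_coe_sort φ.range]
  simp_rw [mul_comm]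

/-- The Laplace functional of a Poisson process. -/
theorem IsPoissonProcess.lintegral_negExp_tsum (hw : IsPoissonProcess P ν w)
    [IsProbabilityMeasure P] {φ : E → ℝ≥0∞} (hφ : Measurable φ) :
    ∫⁻ ω, negExp (∑' j, φ (w j ω)) ∂P = negExp (∫⁻ x, (1 - negExp (φ x)) ∂ν) := by
  have hsup : ∀ x, Filter.Tendsto (fun n => SimpleFunc.eapprox φ n x) Filter.atTop (nhds (φ x)) := by
    intro x
    rw [← SimpleFunc.iSup_eapprox_apply hφ x]
    exact tendsto_atTop_iSup fun _ _ h => SimpleFunc.monotone_eapprox φ h x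
  -- These integrands decrease in `n`, so the bound `1` and dominated convergence are used; on the
  -- right-hand side `1 - e^{-φ}` increases and monotone convergence applies.
  have hL : Filter.Tendsto (fun n => ∫⁻ ω, negExp (∑' j, SimpleFunc.eapprox φ n (w j ω)) ∂P)
      Filter.atTop (nhds (∫⁻ ω, negExp (∑' j, φ (w j ω)) ∂P)) := by
    refine tendsto_lintegral_of_dominated_convergence (fun _ => 1) (fun n => ?_) (fun n => ?_)
      (by simp) ?_
    · exact measurable_negExp.comp (Measurable.tsum fun j =>
        (SimpleFunc.measurable _).comp (hw.measurable j))
    · exact .of_forall fun ω => negExp_le_one _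
    · refine .of_forall fun ω => (continuous_negExp.tendsto _).comp ?_
      have h1 : ∑' j, φ (w j ω) = ⨆ n, ∑' j, SimpleFunc.eapprox φ n (w j ω) := by
        simp_rw [← lintegral_count (α := ℕ)]
        have h2 := lintegral_iSup (μ := Measure.count)
          (f := fun n (j : ℕ) => SimpleFunc.eapprox φ n (w j ω)) (fun _ => measurable_of_countable _)
          (fun _ _ h j => SimpleFunc.monotone_eapprox φ h _)
        simp_rw [SimpleFunc.iSup_eapprox_apply hφ] at h2
        exact h2
      rw [h1]
      exact tendsto_atTop_iSup fun _ _ h =>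
        ENNReal.tsum_le_tsum fun j => SimpleFunc.monotone_eapprox φ h _
  have hR : Filter.Tendsto (fun n => negExp (∫⁻ x, (1 - negExp (SimpleFunc.eapprox φ n x)) ∂ν))
      Filter.atTop (nhds (negExp (∫⁻ x, (1 - negExp (φ x)) ∂ν))) := by
    refine (continuous_negExp.tendsto _).comp ?_
    refine lintegral_tendsto_of_tendsto_of_monotone (fun n => by fun_prop) ?_ ?_
    · exact .of_forall fun x _ _ h =>
        tsub_le_tsub_left (antitone_negExp (SimpleFunc.monotone_eapprox φ h x)) _
    · refine .of_forall fun x => ENNReal.Tendsto.sub tendsto_const_nhds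
        ((continuous_negExp.tendsto _).comp (hsup x)) (by simp)
  simp_rw [hw.lintegral_negExp_tsum_simpleFunc] at hL
  exact tendsto_nhds_unique hL hR

end LaplaceFunctional

/-! ### Difference quotients of the exponential, used as monotone derivatives. -/

/-- The difference quotient `2ⁿ (1 - e^{-x / 2ⁿ})`, which increases to `x`. -/
noncomputable def negExpQuot (n : ℕ) (x : ℝ≥0∞) : ℝ≥0∞ := 2 ^ n * (1 - negExp (x / 2 ^ n))

@[fun_prop]
lemma measurable_negExpQuot (n : ℕ) : Measurable (negExpQuot n) := by
  unfold negExpQuot; fun_prop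

lemma negExpQuot_mono_right (n : ℕ) : Monotone (negExpQuot n) := fun _ _ h =>
  mul_le_mul_right (tsub_le_tsub_left (antitone_negExp (ENNReal.div_le_div_right h _)) _) _

/-- With `y = e^{-x / 2^{n+1}}` this is `1 - y² ≤ 2 (1 - y)`, that is, `(1 - y)² ≥ 0`. Dyadic steps
are used because halving the step turns `y²` into `y`. -/
lemma negExpQuot_mono_left (x : ℝ≥0∞) : Monotone fun n => negExpQuot n x := by
  refine monotone_nat_of_le_succ fun n => ?_
  set y := negExp (x / 2 ^ (n + 1)) with hy
  have h2 : negExp (x / 2 ^ n) = y * y := by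
    rw [hy, ← negExp_add, pow_succ, div_eq_mul_inv x (2 ^ n * 2), ENNReal.mul_inv (by simp) (by simp),
      ← mul_assoc, ← div_eq_mul_inv, ← div_eq_mul_inv, ENNReal.add_halves]
  have hy1 : y ≤ 1 := negExp_le_one _
  rw [negExpQuot, negExpQuot, h2, ← hy, pow_succ, mul_assoc]
  refine mul_le_mul_right (tsub_le_iff_right.2 ?_) _
  obtain ⟨d, hd⟩ := exists_add_of_le hy1
  have hd' : 1 - y = d := by
    rw [hd, ENNReal.add_sub_cancel_left (hy ▸ negExp_ne_top _)]
  rw [hd', two_mul]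
  calc (1 : ℝ≥0∞) = d + y * 1 := by rw [mul_one, add_comm, ← hd]
    _ = d + (y * y + y * d) := by rw [hd, mul_add]
    _ ≤ d + (y * y + 1 * d) := by gcongr
    _ = d + d + y * y := by ring

/-- For finite `x` and `u = x / 2^n`, the bounds `1 + u ≤ e^u` and `1 - u ≤ e^{-u}` squeeze the
quotient between `x / (1 + u)` and `x`. -/
lemma tendsto_negExpQuot (x : ℝ≥0∞) :
    Filter.Tendsto (fun n => negExpQuot n x) Filter.atTop (nhds x) := by
  rcases eq_or_ne x ∞ with rfl | hx
  · have : (fun n => negExpQuot n ∞) = fun n => (2 : ℝ≥0∞) ^ n := by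
      ext n
      rw [negExpQuot, ENNReal.top_div_of_ne_top (by simp)]; simp
    rw [this]
    exact ENNReal.tendsto_pow_atTop_nhds_top_iff.2 (by norm_num)
  · lift x to ℝ≥0 using hx
    have key : ∀ n, negExpQuot n x = ENNReal.ofReal (2 ^ n * (1 - Real.exp (-(x / 2 ^ n)))) := by
      intro n
      have h1 : (x : ℝ≥0∞) / 2 ^ n = ENNReal.ofReal (x / 2 ^ n) := by
        rw [ENNReal.ofReal_div_of_pos (by positivity), ENNReal.ofReal_pow (by norm_num)]
        simp
      rw [negExpQuot, h1, negExp_ofReal (by positivity), ENNReal.ofReal_mul (by positivity),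
        ENNReal.ofReal_sub _ (Real.exp_nonneg _), ENNReal.ofReal_pow (by norm_num)]
      simp
    simp_rw [key]
    rw [← ENNReal.ofReal_coe_nnreal]
    refine ENNReal.tendsto_ofReal ?_
    have h0 : Filter.Tendsto (fun n : ℕ => (x : ℝ) / 2 ^ n) Filter.atTop (nhds 0) :=
      tendsto_const_nhds.div_atTop (tendsto_pow_atTop_atTop_of_one_lt (by norm_num))
    have h1 : Filter.Tendsto (fun n : ℕ => (x : ℝ) / (1 + x / 2 ^ n)) Filter.atTop (nhds x) := by
      have := (tendsto_const_nhds (x := (x : ℝ))).div (h0.const_add 1) (by norm_num)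
      rwa [add_zero, div_one] at this
    refine tendsto_of_tendsto_of_tendsto_of_le_of_le h1 tendsto_const_nhds (fun n => ?_) fun n => ?_
    · set u : ℝ := x / 2 ^ n with hu
      have hu0 : 0 ≤ u := by positivity
      have hx : (x : ℝ) = 2 ^ n * u := by rw [hu]; field_simp
      have h2 : Real.exp (-u) ≤ 1 / (1 + u) := by
        rw [Real.exp_neg, ← one_div]
        exact one_div_le_one_div_of_le (by positivity) (by linarith [Real.add_one_le_exp u])
      have h3 : (x : ℝ) / (1 + u) = 2 ^ n * (1 - 1 / (1 + u)) := by
        rw [hx]; field_simp; ring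
      change (x : ℝ) / (1 + u) ≤ _
      rw [h3]
      gcongr
    · set u : ℝ := x / 2 ^ n with hu
      have hx : (x : ℝ) = 2 ^ n * u := by rw [hu]; field_simp
      change _ ≤ (x : ℝ)
      rw [hx]
      gcongr
      linarith [Real.add_one_le_exp (-u)]

/-- In the differentiation step the quotient of order `n` is applied to an integral that itself
depends on `n`. Monotonicity in both arguments makes the diagonal limit agree with the iterated one.
-/
lemma tendsto_negExpQuot_of_monotone {b : ℕ → ℝ≥0∞} {c : ℝ≥0∞} (hb : Monotone b)
    (hc : Filter.Tendsto b Filter.atTop (nhds c)) :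
    Filter.Tendsto (fun n => negExpQuot n (b n)) Filter.atTop (nhds c) := by
  have hm : Monotone fun n => negExpQuot n (b n) := fun m n h =>
    (negExpQuot_mono_right m (hb h)).trans (negExpQuot_mono_left _ h)
  have : c = ⨆ n, negExpQuot n (b n) := by
    apply le_antisymm
    · refine le_of_tendsto' hc fun m => le_of_tendsto' (tendsto_negExpQuot (b m)) fun n => ?_
      calc negExpQuot n (b m) ≤ negExpQuot (max m n) (b (max m n)) :=
            (negExpQuot_mono_left _ (le_max_right m n)).trans
              (negExpQuot_mono_right _ (hb (le_max_left m n)))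
        _ ≤ _ := le_iSup (fun n => negExpQuot n (b n)) _
    · refine iSup_le fun n => ?_
      calc negExpQuot n (b n) ≤ b n := (negExpQuot_mono_left (b n)).ge_of_tendsto
            (tendsto_negExpQuot _) n
        _ ≤ c := hb.ge_of_tendsto hc n
  rw [this]
  exact tendsto_atTop_iSup hm

instance countable_embedding_nat {I : Type*} [Finite I] : Countable (I ↪ ℕ) :=
  (DFunLike.coe_injective (F := I ↪ ℕ)).countable

lemma tendsto_tsum_of_monotone {ι : Type*} {f : ℕ → ι → ℝ≥0∞} {g : ι → ℝ≥0∞}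
    (hf : ∀ i, Monotone fun n => f n i)
    (hg : ∀ i, Filter.Tendsto (fun n => f n i) Filter.atTop (nhds (g i))) :
    Filter.Tendsto (fun n => ∑' i, f n i) Filter.atTop (nhds (∑' i, g i)) := by
  let : MeasurableSpace ι := ⊤
  simp_rw [← lintegral_count]
  exact lintegral_tendsto_of_tendsto_of_monotone (fun n => measurable_from_top.aemeasurable)
    (.of_forall hf) (.of_forall hg)

/-- Splits the exponent `∫ (1 - e^{-(φ+ψ)})` into the one for `φ` and an increment; the bounds keep
the truncated subtraction honest. -/
lemma one_sub_mul {p q : ℝ≥0∞} (hp : p ≤ 1) (hq : q ≤ 1) :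
    1 - p * q = 1 - p + p * (1 - q) := by
  lift p to ℝ≥0 using (hp.trans_lt ENNReal.one_lt_top).ne
  lift q to ℝ≥0 using (hq.trans_lt ENNReal.one_lt_top).ne
  have hp' : p ≤ 1 := by exact_mod_cast hp
  have hq' : q ≤ 1 := by exact_mod_cast hq
  norm_cast
  ext
  rw [NNReal.coe_add, NNReal.coe_mul, NNReal.coe_sub hp', NNReal.coe_sub hq',
    NNReal.coe_sub (mul_le_one₀ hp' (by positivity) hq')]
  push_cast; ring

/-! ### Sums over the points outside a set of indices. -/

section SumOff

variable {E : Type*}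

/-- The sum of `φ` over the points of the sequence `w` whose index is not in `s`. -/
noncomputable def sumOff (w : ℕ → E) (s : Set ℕ) (φ : E → ℝ≥0∞) : ℝ≥0∞ :=
  ∑' i, sᶜ.indicator (fun i => φ (w i)) i

lemma sumOff_add (w : ℕ → E) (s : Set ℕ) (φ ψ : E → ℝ≥0∞) :
    sumOff w s (φ + ψ) = sumOff w s φ + sumOff w s ψ := by
  rw [sumOff, sumOff, sumOff, ← ENNReal.tsum_add]
  congr 1 with i
  by_cases hi : i ∈ sᶜ <;> simp [hi]

lemma sumOff_div (w : ℕ → E) (s : Set ℕ) (φ : E → ℝ≥0∞) (c : ℝ≥0∞) :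
    sumOff w s (fun x => φ x / c) = sumOff w s φ / c := by
  simp_rw [sumOff, div_eq_mul_inv, ← ENNReal.tsum_mul_right]
  congr 1 with i
  by_cases hi : i ∈ sᶜ <;> simp [hi]

lemma sumOff_eq_tsum_compl (w : ℕ → E) (s : Set ℕ) (φ : E → ℝ≥0∞) :
    sumOff w s φ = ∑' i : ↥sᶜ, φ (w i) :=
  (tsum_subtype sᶜ fun i => φ (w i)).symm

lemma sumOff_eq_add_insert (w : ℕ → E) {s : Set ℕ} {i : ℕ} (hi : i ∉ s) (φ : E → ℝ≥0∞) :
    sumOff w s φ = φ (w i) + sumOff w (insert i s) φ := by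
  rw [sumOff, ENNReal.tsum_eq_add_tsum_ite i, Set.indicator_of_mem (show i ∈ sᶜ from hi), sumOff]
  congr 2 with k
  by_cases hk : k = i
  · simp [hk]
  · by_cases hks : k ∈ s <;> simp [hk, hks]

end SumOff

/-! ### The multivariate Mecke formula. -/

section Mecke

variable {Ω E : Type*} [MeasurableSpace Ω] [MeasurableSpace E] {P : Measure Ω} {ν : Measure E}
  {w : ℕ → Ω → E}

lemma measurable_sumOff (hw : ∀ j, Measurable (w j)) (s : Set ℕ) {φ : E → ℝ≥0∞}
    (hφ : Measurable φ) : Measurable fun ω => sumOff (fun i => w i ω) s φ := by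
  refine Measurable.tsum fun i => ?_
  by_cases hi : i ∈ sᶜ
  · simpa [Set.indicator_of_mem hi, Function.comp_def] using hφ.comp (hw i)
  · simp [Set.indicator_of_notMem hi]

/-- One differentiation step in the proof of the multivariate Mecke formula. -/
lemma lintegral_tsum_mul_sumOff {ι : Type*} [Countable ι] (hw : ∀ j, Measurable (w j))
    (A : ι → Ω → ℝ≥0∞) (hA : ∀ j, Measurable (A j)) (s : ι → Set ℕ) (a : ℝ≥0∞) (ha : a ≠ ∞)
    (h : ∀ φ : E → ℝ≥0∞, Measurable φ → (∀ x, φ x ≠ ∞) →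
      ∫⁻ ω, ∑' j, A j ω * negExp (sumOff (fun i => w i ω) (s j) φ) ∂P
        = negExp (∫⁻ x, (1 - negExp (φ x)) ∂ν) * a)
    {φ g : E → ℝ≥0∞} (hφ : Measurable φ) (hφ' : ∀ x, φ x ≠ ∞) (hg : Measurable g)
    (hg' : ∀ x, g x ≠ ∞) :
    ∫⁻ ω, ∑' j, A j ω * negExp (sumOff (fun i => w i ω) (s j) φ)
        * sumOff (fun i => w i ω) (s j) g ∂P
      = negExp (∫⁻ x, (1 - negExp (φ x)) ∂ν) * a * ∫⁻ x, negExp (φ x) * g x ∂ν := by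
  set c := negExp (∫⁻ x, (1 - negExp (φ x)) ∂ν) with hc
  have hmeas : ∀ (f : ℝ≥0∞ → ℝ≥0∞), Measurable f → Measurable fun ω => ∑' j, A j ω *
      negExp (sumOff (fun i => w i ω) (s j) φ) * f (sumOff (fun i => w i ω) (s j) g) := by
    intro f hf
    refine Measurable.tsum fun j => ((hA j).mul ?_).mul ?_
    · exact measurable_negExp.comp (measurable_sumOff hw _ hφ)
    · exact hf.comp (measurable_sumOff hw _ hg)
  have step : ∀ n, ∫⁻ ω, ∑' j, A j ω * negExp (sumOff (fun i => w i ω) (s j) φ)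
        * negExpQuot n (sumOff (fun i => w i ω) (s j) g) ∂P
      = c * a * negExpQuot n (∫⁻ x, negExp (φ x) * negExpQuot n (g x) ∂ν) := by
    intro n
    -- The hypothesis is compared at `φ` and at `φ + ε g` with `ε = 2^{-n}`; the difference divided
    -- by `ε` is the quotient wanted.
    have h1 := h (φ + fun x => g x / 2 ^ n) (by fun_prop) (fun x => by
      simpa using ⟨hφ' x, (ENNReal.div_lt_top (hg' x) (by simp)).ne⟩)
    have h2 := h φ hφ hφ'
    have e1 : ∫⁻ x, (1 - negExp ((φ + fun x => g x / 2 ^ n) x)) ∂ν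
        = ∫⁻ x, (1 - negExp (φ x)) ∂ν + ∫⁻ x, negExp (φ x) * (1 - negExp (g x / 2 ^ n)) ∂ν := by
      rw [← lintegral_add_left (by fun_prop)]
      congr 1 with x
      rw [Pi.add_apply, negExp_add]
      exact one_sub_mul (negExp_le_one _) (negExp_le_one _)
    have e2 : ∫⁻ x, negExp (φ x) * negExpQuot n (g x) ∂ν
        = 2 ^ n * ∫⁻ x, negExp (φ x) * (1 - negExp (g x / 2 ^ n)) ∂ν := by
      rw [← lintegral_const_mul _ (by fun_prop)]
      congr 1 with x
      rw [negExpQuot]; ring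
    set b := ∫⁻ x, negExp (φ x) * (1 - negExp (g x / 2 ^ n)) ∂ν with hb
    have e3 : negExpQuot n (2 ^ n * b) = 2 ^ n * (1 - negExp b) := by
      rw [negExpQuot, mul_comm _ b, ENNReal.mul_div_cancel_right (by simp) (by simp)]
    rw [e1, negExp_add, ← hc] at h1
    -- The difference is written as a sum, so that the common finite term (finite because `a ≠ ∞`)
    -- can be cancelled instead of subtracting inside integrals.
    have e4 : ∀ ω, ∑' j, A j ω * negExp (sumOff (fun i => w i ω) (s j) φ)
        = ∑' j, A j ω * negExp (sumOff (fun i => w i ω) (s j) (φ + fun x => g x / 2 ^ n))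
        + ∑' j, A j ω * negExp (sumOff (fun i => w i ω) (s j) φ)
          * (1 - negExp (sumOff (fun i => w i ω) (s j) g / 2 ^ n)) := by
      intro ω
      rw [← ENNReal.tsum_add]
      congr 1 with j
      rw [sumOff_add, sumOff_div, negExp_add, ← mul_assoc, ← mul_add,
        add_tsub_cancel_of_le (negExp_le_one _), mul_one]
    have e5 : c * a * (1 - negExp b) + c * negExp b * a = c * a := by
      rw [mul_right_comm c (negExp b), ← mul_add, tsub_add_cancel_of_le (negExp_le_one _), mul_one]
    simp_rw [e4] at h2
    rw [lintegral_add_right _ (hmeas (fun x => 1 - negExp (x / 2 ^ n)) (by fun_prop)), h1, ← e5,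
      add_comm, ENNReal.add_left_inj (by
        exact ENNReal.mul_ne_top (ENNReal.mul_ne_top (negExp_ne_top _) (negExp_ne_top _)) ha)] at h2
    rw [e2, e3, mul_left_comm, ← h2,
      ← lintegral_const_mul _ (hmeas (fun x => 1 - negExp (x / 2 ^ n)) (by fun_prop))]
    congr 1 with ω
    rw [← ENNReal.tsum_mul_left]
    congr 1 with j
    rw [negExpQuot]; ring
  have hL : Filter.Tendsto (fun n => ∫⁻ ω, ∑' j, A j ω *
      negExp (sumOff (fun i => w i ω) (s j) φ)
        * negExpQuot n (sumOff (fun i => w i ω) (s j) g) ∂P) Filter.atTop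
      (nhds (∫⁻ ω, ∑' j, A j ω * negExp (sumOff (fun i => w i ω) (s j) φ)
        * sumOff (fun i => w i ω) (s j) g ∂P)) := by
    refine lintegral_tendsto_of_tendsto_of_monotone
      (fun n => (hmeas _ (measurable_negExpQuot n)).aemeasurable) (.of_forall fun ω m n hmn =>
        ENNReal.tsum_le_tsum fun j => mul_le_mul_right (negExpQuot_mono_left _ hmn) _)
      (.of_forall fun ω => ?_)
    refine tendsto_tsum_of_monotone (fun j m n hmn =>
      mul_le_mul_right (negExpQuot_mono_left _ hmn) _) fun j => ?_
    -- The coefficient `A j ω` may be infinite, so multiplying the limit by it needs a nonzero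
    -- limit; when the limit is zero the quotients vanish identically.
    rcases eq_or_ne (sumOff (fun i => w i ω) (s j) g) 0 with h0 | h0
    · simp [h0, negExpQuot]
    · exact ENNReal.Tendsto.const_mul (tendsto_negExpQuot _) (.inl h0)
  have hR : Filter.Tendsto
      (fun n => c * a * negExpQuot n (∫⁻ x, negExp (φ x) * negExpQuot n (g x) ∂ν)) Filter.atTop
      (nhds (c * a * ∫⁻ x, negExp (φ x) * g x ∂ν)) := by
    refine ENNReal.Tendsto.const_mul ?_ (.inr (ENNReal.mul_ne_top (negExp_ne_top _) ha))
    refine tendsto_negExpQuot_of_monotone (fun m n hmn => lintegral_mono fun x =>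
      mul_le_mul_right (negExpQuot_mono_left _ hmn) _) ?_
    refine lintegral_tendsto_of_tendsto_of_monotone (fun n => by fun_prop)
      (.of_forall fun x m n hmn => mul_le_mul_right (negExpQuot_mono_left _ hmn) _)
      (.of_forall fun x => ?_)
    exact ENNReal.Tendsto.const_mul (tendsto_negExpQuot _) (.inr (negExp_ne_top _))
  simp_rw [step] at hL
  exact tendsto_nhds_unique hL hR

/-- The multivariate Mecke formula for a Poisson process, tested against products. -/
theorem IsPoissonProcess.lintegral_tsum_embedding [IsProbabilityMeasure P]
    (hw : IsPoissonProcess P ν w) (I : Type*) [Fintype I] :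
    ∀ (g : I → E → ℝ≥0∞) (_ : ∀ k, Measurable (g k)) (_ : ∀ k x, g k x ≠ ∞)
      (_ : ∀ k, ∫⁻ x, g k x ∂ν ≠ ∞) (φ : E → ℝ≥0∞) (_ : Measurable φ) (_ : ∀ x, φ x ≠ ∞),
    ∫⁻ ω, ∑' j : I ↪ ℕ, (∏ k, g k (w (j k) ω)) * negExp (sumOff (fun i => w i ω) (range j) φ) ∂P
      = negExp (∫⁻ x, (1 - negExp (φ x)) ∂ν) * ∏ k, ∫⁻ x, g k x ∂ν := by
  refine Fintype.induction_empty_option (P := fun I _ =>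
    ∀ (g : I → E → ℝ≥0∞) (_ : ∀ k, Measurable (g k)) (_ : ∀ k x, g k x ≠ ∞)
      (_ : ∀ k, ∫⁻ x, g k x ∂ν ≠ ∞) (φ : E → ℝ≥0∞) (_ : Measurable φ) (_ : ∀ x, φ x ≠ ∞),
    ∫⁻ ω, ∑' j : I ↪ ℕ, (∏ k, g k (w (j k) ω)) * negExp (sumOff (fun i => w i ω) (range j) φ) ∂P
      = negExp (∫⁻ x, (1 - negExp (φ x)) ∂ν) * ∏ k, ∫⁻ x, g k x ∂ν) ?_ ?_ ?_ I
  · intro α β _ e ih g hg hg' hgi φ hφ hφ'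
    have := ih (fun k => g (e k)) (fun k => hg _) (fun k => hg' _) (fun k => hgi _) φ hφ hφ'
    let fα := Fintype.ofEquiv β e.symm
    rw [← Equiv.prod_comp e (fun k => ∫⁻ x, g k x ∂ν), ← this]
    congr 1 with ω
    rw [← (e.embeddingCongr (Equiv.refl ℕ)).tsum_eq]
    congr 1 with j
    congr 1
    · rw [← Equiv.prod_comp e]
      simp [Equiv.embeddingCongr]
    · congr 2
      ext x; simp [Equiv.embeddingCongr, e.symm.surjective.exists]
  -- With no distinguished point the formula is the Laplace functional.
  · intro g _ _ _ φ hφ _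
    simp [sumOff, hw.lintegral_negExp_tsum hφ]
  · intro α _ ih g hg hg' hgi φ hφ hφ'
    -- The new point is produced by differentiating in the direction `g e^{φ}`. The factor `e^{φ}`,
    -- finite since `φ` is, makes up for the new point leaving the sum in the exponent.
    have hstep := lintegral_tsum_mul_sumOff (P := P) (ν := ν) hw.measurable
      (fun (j : α ↪ ℕ) ω => ∏ k, g (some k) (w (j k) ω))
      (fun j => Finset.measurable_prod _ fun k _ => (hg _).comp (hw.measurable _))
      (fun j => range j) (∏ k, ∫⁻ x, g (some k) x ∂ν) (ENNReal.prod_ne_top fun k _ => hgi _)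
      (fun φ hφ hφ' => ih (fun k => g (some k)) (fun k => hg _) (fun k => hg' _) (fun k => hgi _)
        φ hφ hφ') hφ hφ' (g := fun x => g none x * (negExp (φ x))⁻¹)
      ((hg none).mul (by fun_prop))
      (fun x => ENNReal.mul_ne_top (hg' _ _) (ENNReal.inv_ne_top.2 (negExp_ne_zero (hφ' x))))
    have e1 : ∀ x, negExp (φ x) * (g none x * (negExp (φ x))⁻¹) = g none x := by
      intro x
      rw [mul_left_comm, ENNReal.mul_inv_cancel (negExp_ne_zero (hφ' x)) (negExp_ne_top _), mul_one]
    simp_rw [e1] at hstep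
    rw [Fintype.prod_option, mul_comm (∫⁻ x, g none x ∂ν), ← mul_assoc, ← hstep]
    congr 1 with ω
    -- An embedding of `Option α` is one of `α` plus an index outside its range, so summing over
    -- that index gives a `sumOff`.
    rw [← (Function.Embedding.optionEmbeddingEquiv α ℕ).symm.tsum_eq, ENNReal.tsum_sigma']
    congr 1 with j
    rw [sumOff_eq_tsum_compl _ _ (fun x => g none x * (negExp (φ x))⁻¹), ← ENNReal.tsum_mul_left]
    congr 1 with i
    have hr : range ((Function.Embedding.optionEmbeddingEquiv α ℕ).symm ⟨j, i⟩)
        = insert i.1 (range j) := by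
      ext x; simp [Option.exists, eq_comm]
    rw [hr, Fintype.prod_option, sumOff_eq_add_insert _ i.2 φ, negExp_add]
    simp only [Function.Embedding.optionEmbeddingEquiv_symm_apply,
      Function.Embedding.optionElim_apply]
    change (g none (w i ω) * ∏ k, g (some k) (w (j k) ω)) * _ = _
    set p := negExp (φ (w i ω)) with hp
    have : p * p⁻¹ = 1 := ENNReal.mul_inv_cancel (negExp_ne_zero (hφ' _)) (negExp_ne_top _)
    rw [show (∏ k, g (some k) (w (j k) ω)) * (p * negExp (sumOff (fun i => w i ω) (insert (↑i) (range j)) φ)) *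
      (g none (w i ω) * p⁻¹) = (g none (w i ω) * (∏ k, g (some k) (w (j k) ω))) *
        negExp (sumOff (fun i => w i ω) (insert (↑i) (range j)) φ) * (p * p⁻¹) by ring, this, mul_one]

end Mecke

/-! ### Integrals against the Lévy intensity. -/

section LevyIntegrals

variable {α τ z : ℝ}

@[fun_prop]
lemma measurable_levyIntensity (α τ : ℝ) : Measurable (levyIntensity α τ) := by
  unfold levyIntensity; fun_prop

lemma levyIntensity_nonneg (hα : 0 < α) {w : ℝ} (hw : 0 < w) : 0 ≤ levyIntensity α τ w := by
  unfold levyIntensity; positivity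

lemma tiltedIntensity_eq (n : ℕ) {w : ℝ} (hw : 0 < w) :
    levyIntensity α τ w * w ^ n * Real.exp (-(z * w))
      = α * (w ^ ((n : ℝ) - 1) * Real.exp (-((z + τ) * w))) := by
  have h1 : w ^ ((n : ℝ) - 1) = w ^ n * w⁻¹ := by
    rw [Real.rpow_sub hw, Real.rpow_natCast, Real.rpow_one, div_eq_mul_inv]
  have h2 : Real.exp (-((z + τ) * w)) = Real.exp (-(τ * w)) * Real.exp (-(z * w)) := by
    rw [← Real.exp_add]; congr 1; ring
  rw [h1, h2, levyIntensity]; ring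

lemma integrableOn_tiltedIntensity (hτ : 0 < τ) {n : ℕ} (hn : 1 ≤ n) (hz : 0 ≤ z) :
    IntegrableOn (fun w => levyIntensity α τ w * w ^ n * Real.exp (-(z * w))) (Ioi 0) := by
  have hn' : (1 : ℝ) ≤ n := by exact_mod_cast hn
  have h := (integrableOn_rpow_mul_exp_neg_mul_rpow (p := 1) (s := (n : ℝ) - 1) (b := z + τ)
    (by linarith) one_pos (by linarith)).const_mul α
  refine IntegrableOn.congr_fun h (fun w hw => ?_) measurableSet_Ioi
  simp only [Real.rpow_one]
  rw [tiltedIntensity_eq n hw, neg_mul]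

lemma tiltedMoment_eq (hτ : 0 < τ) {n : ℕ} (hn : 1 ≤ n) (hz : 0 ≤ z) :
    tiltedMoment α τ n z = α / (z + τ) ^ n * Real.Gamma n := by
  have hn' : (0 : ℝ) < n := by exact_mod_cast hn
  rw [tiltedMoment, setIntegral_congr_fun measurableSet_Ioi
    (fun w (hw : 0 < w) => tiltedIntensity_eq (z := z) (α := α) (τ := τ) n hw),
    integral_const_mul, Real.integral_rpow_mul_exp_neg_mul_Ioi hn' (by linarith),
    Real.rpow_natCast, ← mul_assoc, one_div, inv_pow, div_eq_mul_inv]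

/-- Since `1 - e^{-zw} ≤ z w`, the singularity `w⁻¹` is cancelled and `z λ(w) w` dominates. -/
lemma integrableOn_laplaceIntegrand (hα : 0 < α) (hτ : 0 < τ) (hz : 0 ≤ z) :
    IntegrableOn (fun w => levyIntensity α τ w * (1 - Real.exp (-(z * w)))) (Ioi 0) := by
  have h := (integrableOn_tiltedIntensity (α := α) (z := 0) hτ le_rfl le_rfl).const_mul z
  refine h.mono' (by fun_prop) ?_
  filter_upwards [ae_restrict_mem measurableSet_Ioi] with w hw
  have hw0 : 0 ≤ w := le_of_lt hw
  have h0 := levyIntensity_nonneg (τ := τ) hα hw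
  have h1 : Real.exp (-(z * w)) ≤ 1 := Real.exp_le_one_iff.2 (by nlinarith)
  have h2 := Real.add_one_le_exp (-(z * w))
  rw [Real.norm_of_nonneg (mul_nonneg h0 (by linarith))]
  simp only [pow_one, zero_mul, neg_zero, Real.exp_zero, mul_one]
  nlinarith

/-- A Frullani integral of `e^{-x}` with scales `τ` and `τ + z`; the limits of `e^{-x}` at `0` and
at infinity are `1` and `0`. -/
lemma laplaceExponent_eq (hα : 0 < α) (hτ : 0 < τ) (hz : 0 ≤ z) :
    laplaceExponent α τ z = α * Real.log (1 + z / τ) := by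
  have hc : Continuous fun x : ℝ => Real.exp (-x) := by fun_prop
  have e : ∀ w : ℝ, levyIntensity α τ w * (1 - Real.exp (-(z * w)))
      = α * (w⁻¹ • (Real.exp (-(τ * w)) - Real.exp (-((τ + z) * w)))) := by
    intro w
    have : Real.exp (-((τ + z) * w)) = Real.exp (-(τ * w)) * Real.exp (-(z * w)) := by
      rw [← Real.exp_add]; congr 1; ring
    rw [this, levyIntensity, smul_eq_mul]; ring
  have hint := integrableOn_laplaceIntegrand hα hτ hz
  simp_rw [e] at hint
  have hint' : IntegrableOn
      (fun w : ℝ => w⁻¹ • (Real.exp (-(τ * w)) - Real.exp (-((τ + z) * w)))) (Ioi 0) := by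
    have := hint.const_mul α⁻¹
    simp only [inv_mul_cancel_left₀ hα.ne'] at this
    exact this
  have hF := Frullani.integral_Ioi_eq (f := fun x : ℝ => Real.exp (-x)) (a := τ) (b := τ + z)
    (L := 1) (R := 0) (hc.locallyIntegrable.locallyIntegrableOn _) hτ (by linarith)
    ((by simpa using hc.tendsto 0 : Filter.Tendsto _ (nhds (0 : ℝ)) (nhds (1 : ℝ))).mono_left
      nhdsWithin_le_nhds)
    (Real.tendsto_exp_neg_atTop_nhds_zero) hint'
  rw [laplaceExponent]
  simp_rw [e]
  rw [integral_const_mul, hF, sub_zero, smul_eq_mul, mul_one, add_div, div_self hτ.ne']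

lemma lintegral_levyMeasure {f : ℝ → ℝ≥0∞} (hf : Measurable f) :
    ∫⁻ w, f w ∂levyMeasure α τ
      = ∫⁻ w in Ioi 0, ENNReal.ofReal (levyIntensity α τ w) * f w := by
  rw [levyMeasure, lintegral_withDensity_eq_lintegral_mul _ (by fun_prop) hf]
  rfl

lemma levyMeasure_Iic : levyMeasure α τ (Iic 0) = 0 := by
  refine withDensity_absolutelyContinuous _ _ ?_
  rw [Measure.restrict_apply measurableSet_Iic]
  rw [Iic_inter_Ioi, Ioc_self, measure_empty]

lemma lintegral_levyMeasure_tilted (hα : 0 < α) (hτ : 0 < τ) {n : ℕ} (hn : 1 ≤ n) (hz : 0 ≤ z) :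
    ∫⁻ w, ENNReal.ofReal (w ^ n * Real.exp (-(z * w))) ∂levyMeasure α τ
      = ENNReal.ofReal (tiltedMoment α τ n z) := by
  rw [lintegral_levyMeasure (by fun_prop), tiltedMoment, ofReal_integral_eq_lintegral_ofReal
    (integrableOn_tiltedIntensity hτ hn hz)]
  · refine setLIntegral_congr_fun measurableSet_Ioi fun w hw => ?_
    rw [← ENNReal.ofReal_mul (levyIntensity_nonneg hα hw), mul_assoc]
  · filter_upwards [ae_restrict_mem measurableSet_Ioi] with w hw
    have h0 := levyIntensity_nonneg (τ := τ) hα hw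
    have hw0 : (0 : ℝ) < w := hw
    simp only [Pi.zero_apply]
    positivity

lemma lintegral_levyMeasure_one_sub (hα : 0 < α) (hτ : 0 < τ) (hz : 0 ≤ z) :
    ∫⁻ w, (1 - negExp (ENNReal.ofReal (z * w))) ∂levyMeasure α τ
      = ENNReal.ofReal (laplaceExponent α τ z) := by
  rw [lintegral_levyMeasure (by fun_prop), laplaceExponent, ofReal_integral_eq_lintegral_ofReal
    (integrableOn_laplaceIntegrand hα hτ hz)]
  · refine setLIntegral_congr_fun measurableSet_Ioi fun w hw => ?_
    have hw0 : (0 : ℝ) < w := hw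
    rw [ENNReal.ofReal_mul (levyIntensity_nonneg hα hw), negExp_ofReal (by positivity),
      ENNReal.ofReal_sub _ (Real.exp_nonneg _), ENNReal.ofReal_one]
  · filter_upwards [ae_restrict_mem measurableSet_Ioi] with w hw
    have h0 := levyIntensity_nonneg (τ := τ) hα hw
    have hw0 : (0 : ℝ) < w := hw
    refine mul_nonneg h0 (sub_nonneg.2 (Real.exp_le_one_iff.2 (by nlinarith)))

lemma laplaceExponent_nonneg (hα : 0 < α) (hτ : 0 < τ) (hz : 0 ≤ z) :
    0 ≤ laplaceExponent α τ z := by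
  rw [laplaceExponent_eq hα hτ hz]
  exact mul_nonneg hα.le (Real.log_nonneg (by linarith [div_nonneg hz hτ.le]))

lemma tiltedMoment_nonneg (hα : 0 < α) (hτ : 0 < τ) {n : ℕ} (hn : 1 ≤ n) (hz : 0 ≤ z) :
    0 ≤ tiltedMoment α τ n z := by
  rw [tiltedMoment_eq hτ hn hz]
  have : (0 : ℝ) < n := by exact_mod_cast hn
  have := Real.Gamma_pos_of_pos this
  positivity

end LevyIntegrals

/-! ### Finite products of densities, multiples and sums of measures. -/

section ProductMeasures

lemma lintegral_fin_prod_eq_prod {n : ℕ} {E : Fin n → Type*}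
    {mE : ∀ i, MeasurableSpace (E i)} {μ : (i : Fin n) → Measure (E i)} [∀ i, SigmaFinite (μ i)]
    {f : (i : Fin n) → E i → ℝ≥0∞} (hf : ∀ i, Measurable (f i)) :
    ∫⁻ x, ∏ i, f i (x i) ∂(Measure.pi μ) = ∏ i, ∫⁻ x, f i x ∂(μ i) := by
  induction n with
  | zero => simp
  | succ n ih =>
    have hcons : Measurable fun p : E 0 × ((i : Fin n) → E i.succ) =>
        (Fin.cons p.1 p.2 : (i : Fin (n + 1)) → E i) := by
      refine measurable_pi_lambda _ fun i => ?_
      cases i using Fin.cases with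
      | zero => exact measurable_fst
      | succ i => exact (measurable_pi_apply i).comp measurable_snd
    have hpi : Measure.pi μ = ((μ 0).prod (Measure.pi fun i : Fin n => μ i.succ)).map
        fun p => (Fin.cons p.1 p.2 : (i : Fin (n + 1)) → E i) := by
      refine Measure.pi_eq fun s hs => ?_
      have : (fun p : E 0 × ((i : Fin n) → E i.succ) =>
          (Fin.cons p.1 p.2 : (i : Fin (n + 1)) → E i)) ⁻¹' univ.pi s
          = s 0 ×ˢ univ.pi fun i : Fin n => s i.succ := by
        ext p; simp [Fin.forall_fin_succ]
      rw [Measure.map_apply hcons (MeasurableSet.univ_pi hs), this, Measure.prod_prod,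
        Measure.pi_pi, Fin.prod_univ_succ]
    have hprod : Measurable fun x : (i : Fin n) → E i.succ => ∏ i, f i.succ (x i) :=
      Finset.measurable_prod _ fun i _ => (hf i.succ).comp (measurable_pi_apply i)
    have hprod' : Measurable fun x : (i : Fin (n + 1)) → E i => ∏ i, f i (x i) :=
      Finset.measurable_prod _ fun i _ => (hf i).comp (measurable_pi_apply i)
    rw [hpi, lintegral_map hprod' hcons]
    simp_rw [Fin.prod_univ_succ, Fin.cons_zero, Fin.cons_succ]
    rw [lintegral_prod_mul (hf 0).aemeasurable hprod.aemeasurable, ih fun i => hf i.succ]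

lemma lintegral_fintype_prod_eq_prod {ι : Type*} [Fintype ι] {E : ι → Type*}
    {mE : ∀ i, MeasurableSpace (E i)} {μ : (i : ι) → Measure (E i)} [∀ i, SigmaFinite (μ i)]
    {f : (i : ι) → E i → ℝ≥0∞} (hf : ∀ i, Measurable (f i)) :
    ∫⁻ x, ∏ i, f i (x i) ∂(Measure.pi μ) = ∏ i, ∫⁻ x, f i x ∂(μ i) := by
  let e := (Fintype.equivFin ι).symm
  rw [← (measurePreserving_piCongrLeft _ e).lintegral_comp_emb
    (MeasurableEquiv.measurableEmbedding _)]
  simp_rw [← e.prod_comp, MeasurableEquiv.coe_piCongrLeft, Equiv.piCongrLeft_apply_apply]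
  exact lintegral_fin_prod_eq_prod fun i => hf _

lemma pi_withDensity_eq {ι : Type*} [Fintype ι] {E : ι → Type*}
    {mE : ∀ i, MeasurableSpace (E i)} {μ : (i : ι) → Measure (E i)} [∀ i, SigmaFinite (μ i)]
    {f : (i : ι) → E i → ℝ≥0∞} (hf : ∀ i, Measurable (f i))
    [∀ i, SigmaFinite ((μ i).withDensity (f i))] :
    Measure.pi (fun i => (μ i).withDensity (f i))
      = (Measure.pi μ).withDensity fun x => ∏ i, f i (x i) := by
  refine Measure.pi_eq fun s hs => ?_
  rw [withDensity_apply _ (MeasurableSet.univ_pi hs), Measure.restrict_pi_pi,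
    lintegral_fintype_prod_eq_prod hf]
  exact Finset.prod_congr rfl fun i _ => (withDensity_apply _ (hs i)).symm

lemma pi_smul_eq {ι : Type*} [Fintype ι] {E : ι → Type*}
    {mE : ∀ i, MeasurableSpace (E i)} {μ : (i : ι) → Measure (E i)} [∀ i, SigmaFinite (μ i)]
    (c : ι → ℝ≥0∞) [∀ i, SigmaFinite (c i • μ i)] :
    Measure.pi (fun i => c i • μ i) = (∏ i, c i) • Measure.pi μ := by
  refine Measure.pi_eq fun s _ => ?_
  simp [Measure.pi_pi, Finset.prod_mul_distrib]

lemma prod_tsum_eq_tsum_prod {n : ℕ} {A : Fin n → Type*} (f : (i : Fin n) → A i → ℝ≥0∞) :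
    ∏ i, ∑' a, f i a = ∑' a : ∀ i, A i, ∏ i, f i (a i) := by
  induction n with
  | zero => simp
  | succ n ih =>
    rw [Fin.prod_univ_succ, ih (fun i a => f i.succ a), ← (Fin.consEquiv A).tsum_eq,
      ENNReal.tsum_prod', ← ENNReal.tsum_mul_right]
    congr 1 with a
    rw [← ENNReal.tsum_mul_left]
    congr 1 with b
    rw [Fin.prod_univ_succ]
    simp [Fin.consEquiv]

/-- Expands the product of the laws of the separate lists into a sum over all tuples of lists; on
boxes it is the distributive law for series in `[0, ∞]`. -/
lemma pi_sum_eq {n : ℕ} {E : Fin n → Type*} {mE : ∀ i, MeasurableSpace (E i)}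
    {A : Fin n → Type*} (ν : (i : Fin n) → A i → Measure (E i)) [∀ i a, SigmaFinite (ν i a)]
    [∀ i, SigmaFinite (Measure.sum (ν i))] :
    Measure.pi (fun i => Measure.sum (ν i))
      = Measure.sum fun a : ∀ i, A i => Measure.pi fun i => ν i (a i) := by
  refine Measure.pi_eq fun s hs => ?_
  rw [Measure.sum_apply _ (MeasurableSet.univ_pi hs)]
  simp_rw [Measure.pi_pi, Measure.sum_apply _ (hs _)]
  exact (prod_tsum_eq_tsum_prod fun i a => ν i a (s i)).symm

/-- Lets the auxiliary variables be indexed by positions `(ℓ, i)` instead of list by list. -/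
lemma pi_pi_eq_map_curry {ι : Type*} [Fintype ι] {κ : ι → Type*} [∀ i, Fintype (κ i)]
    {E : Type*} [MeasurableSpace E] (μ : (Σ i, κ i) → Measure E) [∀ p, SigmaFinite (μ p)] :
    Measure.pi (fun i => Measure.pi fun k => μ ⟨i, k⟩)
      = (Measure.pi μ).map fun z i k => z ⟨i, k⟩ := by
  have h : Measure.pi μ = (Measure.pi (fun i => Measure.pi fun k => μ ⟨i, k⟩)).map
      fun z p => z p.1 p.2 := by
    refine Measure.pi_eq fun s hs => ?_
    rw [Measure.map_apply (by fun_prop) (MeasurableSet.univ_pi hs)]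
    have : (fun (z : (i : ι) → κ i → E) (p : Σ i, κ i) => z p.1 p.2) ⁻¹' univ.pi s
        = univ.pi fun i => univ.pi fun k => s ⟨i, k⟩ := by
      ext z; simp [Sigma.forall]
    rw [this, Measure.pi_pi]
    simp_rw [Measure.pi_pi]
    rw [Fintype.prod_sigma]
  rw [h, Measure.map_map (by fun_prop) (by fun_prop)]
  exact Measure.map_id.symm

end ProductMeasures

/-! ### Cancellation of the rates. -/

/-- The measure `a e^{-r z} dz` on `(0, ∞)`. -/
noncomputable def tiltedLebesgue (a : ℝ) (r : ℝ≥0∞) : Measure ℝ :=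
  ((volume : Measure ℝ).restrict (Ioi 0)).withDensity fun z =>
    ENNReal.ofReal a * negExp (r * ENNReal.ofReal z)

instance (a : ℝ) (r : ℝ≥0∞) : SigmaFinite (tiltedLebesgue a r) :=
  SigmaFinite.withDensity_of_ne_top' fun _ =>
    ENNReal.mul_ne_top ENNReal.ofReal_ne_top (negExp_ne_top _)

lemma smul_expMeasure (a : ℝ) {r : ℝ≥0∞} (hr : r ≠ 0) (hr' : r ≠ ∞) :
    (ENNReal.ofReal a / r) • expMeasure r.toReal = tiltedLebesgue a r := by
  have h1 : expMeasure r.toReal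
      = ((volume : Measure ℝ).restrict (Ioi 0)).withDensity (exponentialPDF r.toReal) := by
    rw [← withDensity_indicator measurableSet_Ioi]
    refine withDensity_congr_ae ?_
    -- The exponential density is supported on the closed half line, the reference measure on the
    -- open one; they differ by a null point.
    have h0 : ∀ᵐ x : ℝ, x ≠ 0 := by simp [ae_iff]
    filter_upwards [h0] with x hx
    by_cases h : x ∈ Ioi (0 : ℝ)
    · rw [indicator_of_mem h]; rfl
    · rw [indicator_of_notMem h]
      exact exponentialPDF_of_neg (lt_of_le_of_ne (not_lt.1 h) hx)
  rw [h1, tiltedLebesgue, ← withDensity_smul _ (by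
    exact (measurable_exponentialPDFReal _).ennreal_ofReal)]
  refine withDensity_congr_ae ?_
  filter_upwards [ae_restrict_mem measurableSet_Ioi] with z hz
  have hz0 : 0 ≤ z := le_of_lt hz
  have hrp := ENNReal.toReal_pos hr hr'
  rw [Pi.smul_apply, exponentialPDF_of_nonneg hz0, smul_eq_mul, ENNReal.ofReal_mul hrp.le,
    ENNReal.ofReal_toReal hr', ← negExp_ofReal (by positivity), ENNReal.ofReal_mul hrp.le,
    ENNReal.ofReal_toReal hr', ← mul_assoc, ENNReal.div_mul_cancel hr hr']

/-! ### The ranking law of a purely atomic measure. -/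

section Atomic

variable {𝕏 : Type*} [MeasurableSpace 𝕏]

/-- The purely atomic measure `∑ⱼ wⱼ δ_{Xⱼ}`. -/
noncomputable def atomicMeasure (w : ℕ → ℝ) (X : ℕ → 𝕏) : Measure 𝕏 :=
  Measure.sum fun j => ENNReal.ofReal (w j) • Measure.dirac (X j)

variable {w : ℕ → ℝ} {X : ℕ → 𝕏}

lemma atomicMeasure_apply {A : Set 𝕏} (hA : MeasurableSet A) :
    atomicMeasure w X A = sumOff w {n | X n ∉ A} ENNReal.ofReal := by
  rw [atomicMeasure, Measure.sum_apply _ hA, sumOff]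
  congr 1 with j
  by_cases h : X j ∈ A <;> simp [Measure.dirac_apply' _ hA, h]

lemma atomicMeasure_univ : atomicMeasure w X univ = ∑' j, ENNReal.ofReal (w j) := by
  simp [atomicMeasure_apply, sumOff]

lemma sumOff_le_tsum {E : Type*} (w : ℕ → E) (s : Set ℕ) (φ : E → ℝ≥0∞) :
    sumOff w s φ ≤ ∑' j, φ (w j) :=
  ENNReal.tsum_le_tsum fun j => indicator_le_self _ (fun i => φ (w i)) j

/-- There are infinitely many atoms, so finitely many draws never exhaust the mass and every rate is
positive. -/
lemma sumOff_pos (hw : ∀ j, 0 < w j) {s : Set ℕ} (hs : s.Finite) :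
    sumOff w s ENNReal.ofReal ≠ 0 := by
  obtain ⟨n, hn⟩ := hs.infinite_compl.nonempty
  rw [sumOff, ne_eq, ENNReal.tsum_eq_zero, not_forall]
  refine ⟨n, ?_⟩
  rw [indicator_of_mem hn]
  simpa using hw n

variable [MeasurableSingletonClass 𝕏]

lemma atomicMeasure_singleton (hX : Function.Injective X) (n : ℕ) :
    atomicMeasure w X {X n} = ENNReal.ofReal (w n) := by
  rw [atomicMeasure, Measure.sum_apply _ (measurableSet_singleton _), tsum_eq_single n]
  · simp
  · intro k hk
    simp [hX.ne hk]

lemma atomicMeasure_singleton_of_notMem {x : 𝕏} (hx : x ∉ range X) :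
    atomicMeasure w X {x} = 0 := by
  rw [atomicMeasure, Measure.sum_apply _ (measurableSet_singleton _), ENNReal.tsum_eq_zero]
  intro k
  have : X k ≠ x := fun h => hx ⟨k, h⟩
  simp [this]

lemma remainingMass_atomicMeasure (hX : Function.Injective X) {m : ℕ} (j : Fin m ↪ ℕ) (i : Fin m) :
    remainingMass (atomicMeasure w X) (X ∘ j) i = sumOff w (j '' Iio i) ENNReal.ofReal := by
  have hmeas : MeasurableSet {x : 𝕏 | ∀ i', i' < i → x ≠ (X ∘ j) i'} := by
    simp only [ofPred_forall]
    exact MeasurableSet.iInter fun i' => MeasurableSet.iInter fun _ =>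
      (measurableSet_singleton _).compl
  rw [remainingMass, atomicMeasure_apply hmeas]
  congr 1
  ext n
  simp [hX.eq_iff, eq_comm]

/-- The law of the auxiliary variables of the list of items with indices `j`, weighted by the
probability of that list. -/
noncomputable def indexedRankingLaw (w : ℕ → ℝ) {m : ℕ} (j : Fin m ↪ ℕ) : Measure (Fin m → ℝ) :=
  Measure.pi fun i => tiltedLebesgue (w (j i)) (sumOff w (j '' Iio i) ENNReal.ofReal)

instance (w : ℕ → ℝ) {m : ℕ} (j : Fin m ↪ ℕ) : SigmaFinite (indexedRankingLaw w j) :=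
  inferInstanceAs (SigmaFinite (Measure.pi _))

/-- The sum over all lists, possibly uncountable, collapses to lists of distinct atoms: any other
list repeats an item or contains a point of mass zero. For the remaining lists `smul_expMeasure`
removes the denominators. -/
lemma rankingLaw_atomicMeasure (hw : ∀ j, 0 < w j) (hsum : ∑' j, ENNReal.ofReal (w j) ≠ ∞)
    (hX : Function.Injective X) (m : ℕ) :
    rankingLaw (atomicMeasure w X) m = Measure.sum fun j : Fin m ↪ ℕ =>
      (Measure.dirac (X ∘ j)).prod (indexedRankingLaw w j) := by
  ext S hS
  rw [rankingLaw, Measure.sum_apply _ hS, Measure.sum_apply _ hS]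
  have hinj : Function.Injective fun j : Fin m ↪ ℕ => X ∘ j := fun j j' h =>
    DFunLike.coe_injective (hX.comp_left h)
  rw [← hinj.tsum_eq]
  · congr 1 with j
    have hr0 : ∀ i : Fin m, sumOff w (j '' Iio i) ENNReal.ofReal ≠ 0 := fun i =>
      sumOff_pos hw ((finite_Iio i).image _)
    have hrt : ∀ i : Fin m, sumOff w (j '' Iio i) ENNReal.ofReal ≠ ∞ := fun i =>
      ne_top_of_le_ne_top hsum (sumOff_le_tsum _ _ _)
    have hP : ∀ i : Fin m, IsProbabilityMeasure
        (expMeasure (sumOff w (j '' Iio i) ENNReal.ofReal).toReal) := fun i =>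
      isProbabilityMeasure_expMeasure (ENNReal.toReal_pos (hr0 i) (hrt i))
    have hσ : ∀ i : Fin m, SigmaFinite ((ENNReal.ofReal (w (j i)) /
        sumOff w (j '' Iio i) ENNReal.ofReal) •
          expMeasure (sumOff w (j '' Iio i) ENNReal.ofReal).toReal) := fun i => by
      rw [smul_expMeasure _ (hr0 i) (hrt i)]; infer_instance
    rw [rankingProb, if_pos (hX.comp j.injective), indexedRankingLaw]
    simp_rw [← smul_expMeasure _ (hr0 _) (hrt _)]
    rw [pi_smul_eq, Measure.prod_smul_right]
    simp_rw [remainingMass_atomicMeasure hX, Function.comp_apply, atomicMeasure_singleton hX]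
  · intro y hy
    by_contra hcon
    apply hy
    have : rankingProb (atomicMeasure w X) y = 0 := by
      rw [rankingProb]
      split_ifs with hyi
      · obtain ⟨i, hi⟩ : ∃ i, y i ∉ range X := by
          by_contra! h
          choose j hj using h
          refine hcon ⟨⟨j, fun a b hab => hyi ?_⟩, funext hj⟩
          rw [← hj, ← hj, hab]
        refine Finset.prod_eq_zero (Finset.mem_univ i) ?_
        rw [atomicMeasure_singleton_of_notMem hi, ENNReal.zero_div]
      · rfl
    simp [this]

/-- The countably many slices `{X ∘ j} × univ` have finite mass and a null complement. This is what
`pi_sum_eq` requires. -/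
lemma sigmaFinite_rankingLaw_atomicMeasure (hw : ∀ j, 0 < w j)
    (hsum : ∑' j, ENNReal.ofReal (w j) ≠ ∞) (hX : Function.Injective X) (m : ℕ) :
    SigmaFinite (Measure.sum fun j : Fin m ↪ ℕ =>
      (Measure.dirac (X ∘ j)).prod (indexedRankingLaw w j)) := by
  set T : (Fin m ↪ ℕ) → Set ((Fin m → 𝕏) × (Fin m → ℝ)) := fun j => {X ∘ j} ×ˢ univ with hT
  have hTm : ∀ j, MeasurableSet (T j) := fun j => (measurableSet_singleton _).prod .univ
  have hinj : Function.Injective fun j : Fin m ↪ ℕ => X ∘ j := fun j j' h =>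
    DFunLike.coe_injective (hX.comp_left h)
  refine Measure.sigmaFinite_of_countable (S := insert (⋃ j, T j)ᶜ (range T))
    ((countable_range T).insert _) ?_ ?_
  · rintro s (rfl | ⟨j, rfl⟩)
    · rw [Measure.sum_apply _ (MeasurableSet.iUnion hTm).compl]
      refine (ENNReal.tsum_eq_zero.2 fun j => ?_).trans_lt ENNReal.zero_lt_top
      refine measure_mono_null (compl_subset_compl.2 (subset_iUnion T j)) ?_
      have : (T j)ᶜ = {X ∘ j}ᶜ ×ˢ univ := by ext; simp [hT]
      rw [this, Measure.prod_prod]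
      simp
    · rw [Measure.sum_apply _ (hTm j), tsum_eq_single j]
      · rw [Measure.prod_prod, indexedRankingLaw, Measure.pi_univ]
        refine ENNReal.mul_lt_top (by simp) (ENNReal.prod_lt_top fun i _ => ?_)
        have hr0 := sumOff_pos hw ((finite_Iio i).image j)
        have hrt := ne_top_of_le_ne_top hsum (sumOff_le_tsum w (j '' Iio i) ENNReal.ofReal)
        have := isProbabilityMeasure_expMeasure (ENNReal.toReal_pos hr0 hrt)
        rw [← smul_expMeasure _ hr0 hrt, Measure.smul_apply, measure_univ, smul_eq_mul, mul_one]
        exact ENNReal.div_lt_top ENNReal.ofReal_ne_top hr0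
      · intro k hk
        rw [Measure.prod_prod, Measure.dirac_apply' _ (measurableSet_singleton _),
          indicator_of_notMem (by simpa using fun h => hk (hinj h)), zero_mul]
  · rw [sUnion_insert, sUnion_range, compl_union_self]

end Atomic

/-! ### Tie patterns and the factorisation over items. -/

section TiePatterns

variable {L : ℕ} {m : Fin L → ℕ}

/-- Lists of distinct indices correspond to a pattern of ties and one index for each class. -/
def listsOfClasses (p : Σ s : TiePattern m, (Quotient s.1 ↪ ℕ)) (ℓ : Fin L) : Fin (m ℓ) ↪ ℕ :=
  ⟨fun i => p.2 (Quotient.mk p.1.1 ⟨ℓ, i⟩), fun i i' h =>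
    p.1.2 ℓ i i' (Quotient.exact (p.2.injective h))⟩

lemma listsOfClasses_apply (p : Σ s : TiePattern m, (Quotient s.1 ↪ ℕ)) (ℓ : Fin L)
    (i : Fin (m ℓ)) : listsOfClasses p ℓ i = p.2 (Quotient.mk p.1.1 ⟨ℓ, i⟩) := rfl

/-- The inverse takes the kernel of the index function on positions as the tie pattern and lets that
function descend to the quotient. -/
lemma listsOfClasses_bijective : Function.Bijective (listsOfClasses (m := m)) := by
  constructor
  · rintro ⟨s, k⟩ ⟨s', k'⟩ h
    have hk : ∀ p : Position m, k (Quotient.mk s.1 p) = k' (Quotient.mk s'.1 p) := fun p =>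
      DFunLike.congr_fun (congrFun h p.1) p.2
    have hs : s = s' := by
      apply Subtype.ext
      ext p q
      have e1 : s.1.r p q ↔ k (Quotient.mk s.1 p) = k (Quotient.mk s.1 q) := by
        rw [k.injective.eq_iff, Quotient.eq]
      have e2 : s'.1.r p q ↔ k' (Quotient.mk s'.1 p) = k' (Quotient.mk s'.1 q) := by
        rw [k'.injective.eq_iff, Quotient.eq]
      exact e1.trans ((by rw [hk, hk] : _ ↔ _).trans e2.symm)
    subst hs
    congr 1
    ext q
    induction q using Quotient.inductionOn with
    | h p => exact hk p
  · intro j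
    let J : Position m → ℕ := fun p => j p.1 p.2
    refine ⟨⟨⟨Setoid.ker J, fun ℓ i i' h => (j ℓ).injective h⟩,
      ⟨Quotient.lift J fun _ _ h => h, ?_⟩⟩, ?_⟩
    · intro a b
      induction a using Quotient.inductionOn with
      | h p =>
        induction b using Quotient.inductionOn with
        | h q => exact fun h => Quotient.sound h
    · rfl

/-- The equivalence given by `listsOfClasses`. -/
noncomputable def listsEquiv :
    (Σ s : TiePattern m, (Quotient s.1 ↪ ℕ)) ≃ ((ℓ : Fin L) → (Fin (m ℓ) ↪ ℕ)) :=
  Equiv.ofBijective _ listsOfClasses_bijective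

instance : Finite (TiePattern m) := by
  have : Finite (Setoid (Position m)) :=
    Finite.of_injective (fun s : Setoid (Position m) => s.r) fun s t h => by
      ext a b; exact iff_of_eq (congrFun (congrFun h a) b)
  exact Subtype.finite

open Classical in
/-- The number of positions in a class of a pattern of ties. -/
noncomputable def classCount (s : TiePattern m) (q : Quotient s.1) : ℕ :=
  (Finset.univ.filter fun p : Position m => Quotient.mk s.1 p = q).card

open Classical in
/-- The indicator that the class `q` does not occur in the list of `p` before `p`. -/
noncomputable def classIndicator (s : TiePattern m) (q : Quotient s.1) (p : Position m) : ℝ :=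
  if ∃ j, j < p.2 ∧ Quotient.mk s.1 ⟨p.1, j⟩ = q then 0 else 1

/-- The sum of the auxiliary variables of the stages at which the class `q` is available. -/
noncomputable def classExposure (s : TiePattern m) (q : Quotient s.1) (z : Position m → ℝ) : ℝ :=
  ∑ p, classIndicator s q p * z p

lemma classCount_pos (s : TiePattern m) (q : Quotient s.1) : 1 ≤ classCount s q := by
  induction q using Quotient.inductionOn with
  | h p => exact Finset.card_pos.2 ⟨p, by simp⟩

lemma classIndicator_nonneg (s : TiePattern m) (q : Quotient s.1) (p : Position m) :
    0 ≤ classIndicator s q p := by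
  unfold classIndicator; split_ifs <;> simp

lemma classExposure_nonneg (s : TiePattern m) (q : Quotient s.1) {z : Position m → ℝ}
    (hz : ∀ p, 0 ≤ z p) : 0 ≤ classExposure s q z :=
  Finset.sum_nonneg fun p _ => mul_nonneg (classIndicator_nonneg s q p) (hz p)

-- Separates the observed atoms still available from the atoms that occur in no list.
open Classical in
lemma sumOff_eq_sum_add_of_subset {E I : Type*} [Fintype I] (w : ℕ → E) (k : I ↪ ℕ) {t : Set ℕ}
    (ht : t ⊆ range k) (φ : E → ℝ≥0∞) :
    sumOff w t φ = (∑ q, if k q ∈ t then 0 else φ (w (k q))) + sumOff w (range k) φ := by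
  have h1 : ∀ i, tᶜ.indicator (fun i => φ (w i)) i
      = (range k).indicator (tᶜ.indicator fun i => φ (w i)) i
        + (range k)ᶜ.indicator (fun i => φ (w i)) i := by
    intro i
    by_cases hi : i ∈ range k
    · simp [hi]
    · have : i ∉ t := fun h => hi (ht h)
      simp [hi, this]
  rw [sumOff, sumOff]
  simp_rw [h1]
  rw [ENNReal.tsum_add, ← tsum_subtype, ← (Equiv.ofInjective k k.injective).tsum_eq, tsum_fintype]
  congr 2 with q
  by_cases h : k q ∈ t <;> simp [h]

/-- The conditional density of the data with a given pattern of ties, in terms of the masses of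
the items, factorised over the items. -/
lemma prod_tiltedLebesgue_density {w : ℕ → ℝ} (hw : ∀ j, 0 < w j) (s : TiePattern m)
    [Fintype (Quotient s.1)] (k : Quotient s.1 ↪ ℕ) {z : Position m → ℝ} (hz : ∀ p, 0 < z p) :
    ∏ p : Position m, (ENNReal.ofReal (w (k (Quotient.mk s.1 p))) *
        negExp (sumOff w (listsOfClasses ⟨s, k⟩ p.1 '' Iio p.2) ENNReal.ofReal
          * ENNReal.ofReal (z p)))
      = (∏ q, ENNReal.ofReal (w (k q) ^ classCount s q *
          Real.exp (-(classExposure s q z * w (k q)))))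
        * negExp (sumOff w (range k) fun x => ENNReal.ofReal ((∑ p, z p) * x)) := by
  classical
  have e1 : ∏ p : Position m, ENNReal.ofReal (w (k (Quotient.mk s.1 p)))
      = ∏ q, ENNReal.ofReal (w (k q)) ^ classCount s q := by
    rw [← Finset.prod_fiberwise' Finset.univ (fun p : Position m => Quotient.mk s.1 p)
      (fun q => ENNReal.ofReal (w (k q)))]
    refine Finset.prod_congr rfl fun q _ => ?_
    rw [Finset.prod_const, classCount]
  -- The rate at `p` is the total unobserved mass plus the masses of the observed classes not yet
  -- drawn in that list.
  have e2 : ∀ p : Position m, sumOff w (listsOfClasses ⟨s, k⟩ p.1 '' Iio p.2) ENNReal.ofReal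
      = (∑ q, ENNReal.ofReal (classIndicator s q p * w (k q)))
        + sumOff w (range k) ENNReal.ofReal := by
    intro p
    rw [sumOff_eq_sum_add_of_subset w k (by
      rintro _ ⟨i, _, rfl⟩
      exact ⟨_, rfl⟩)]
    congr 1
    refine Finset.sum_congr rfl fun q _ => ?_
    have : k q ∈ listsOfClasses ⟨s, k⟩ p.1 '' Iio p.2
        ↔ ∃ j, j < p.2 ∧ Quotient.mk s.1 ⟨p.1, j⟩ = q := by
      simp only [mem_image, mem_Iio, listsOfClasses_apply, k.injective.eq_iff]
    rw [classIndicator]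
    simp only [this]
    split_ifs <;> simp
  have e3 : ∀ x, 0 < x → ENNReal.ofReal ((∑ p, z p) * x)
      = ∑ p, ENNReal.ofReal x * ENNReal.ofReal (z p) := by
    intro x hx
    rw [← Finset.mul_sum, ← ENNReal.ofReal_sum_of_nonneg fun p _ => (hz p).le,
      ← ENNReal.ofReal_mul hx.le, mul_comm]
  have e4 : sumOff w (range k) (fun x => ENNReal.ofReal ((∑ p, z p) * x))
      = ∑ p, sumOff w (range k) ENNReal.ofReal * ENNReal.ofReal (z p) := by
    simp_rw [sumOff, ← ENNReal.tsum_mul_right]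
    rw [← Summable.tsum_finsetSum fun _ _ => ENNReal.summable]
    congr 1 with i
    by_cases hi : i ∈ (range k)ᶜ
    · simp only [indicator_of_mem hi, e3 _ (hw i)]
    · simp only [indicator_of_notMem hi, zero_mul, Finset.sum_const_zero]
  have e5 : ∀ q, ENNReal.ofReal (w (k q) ^ classCount s q *
          Real.exp (-(classExposure s q z * w (k q))))
      = ENNReal.ofReal (w (k q)) ^ classCount s q
        * negExp (∑ p, ENNReal.ofReal (classIndicator s q p * w (k q)) * ENNReal.ofReal (z p)) := by
    intro q
    have hq := (hw (k q)).le
    rw [ENNReal.ofReal_mul (by positivity), ENNReal.ofReal_pow hq,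
      ← negExp_ofReal (mul_nonneg (classExposure_nonneg s q fun p => (hz p).le) hq)]
    congr 2
    rw [classExposure, Finset.sum_mul, ENNReal.ofReal_sum_of_nonneg fun p _ =>
      mul_nonneg (mul_nonneg (classIndicator_nonneg s q p) (hz p).le) hq]
    refine Finset.sum_congr rfl fun p _ => ?_
    rw [← ENNReal.ofReal_mul (mul_nonneg (classIndicator_nonneg s q p) hq)]
    congr 1; ring
  rw [Finset.prod_mul_distrib, e1]
  simp_rw [e5]
  rw [Finset.prod_mul_distrib, mul_assoc]
  congr 1
  -- Exchanging the sums over classes and positions turns rates times `z` into masses times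
  -- exposures.
  rw [← negExp_sum, ← negExp_sum, ← negExp_add, e4, Finset.sum_comm, ← Finset.sum_add_distrib]
  congr 1
  refine Finset.sum_congr rfl fun p _ => ?_
  rw [e2, add_mul, Finset.sum_mul]

variable {𝕏 : Type*} [MeasurableSpace 𝕏]

lemma measurable_assemble (s : TiePattern m) : Measurable (assemble (𝕏 := 𝕏) s) := by
  unfold assemble
  fun_prop

variable [MeasurableSingletonClass 𝕏]

/-- The conditional law of the data given the atoms, decomposed by pattern of ties. -/
lemma pi_rankingLaw_atomicMeasure {w : ℕ → ℝ} {X : ℕ → 𝕏} (hw : ∀ j, 0 < w j)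
    (hsum : ∑' j, ENNReal.ofReal (w j) ≠ ∞) (hX : Function.Injective X)
    [∀ s : TiePattern m, Fintype (Quotient s.1)] {S : Set (RankingData 𝕏 m)}
    (hS : MeasurableSet S) :
    Measure.pi (fun ℓ => rankingLaw (atomicMeasure w X) (m ℓ)) S
      = ∑' s : TiePattern m, ∑' k : Quotient s.1 ↪ ℕ,
        ∫⁻ z, S.indicator 1 (assemble s (X ∘ k, z)) *
          ((∏ q, ENNReal.ofReal (w (k q) ^ classCount s q *
          Real.exp (-(classExposure s q z * w (k q)))))
        * negExp (sumOff w (range k) fun x => ENNReal.ofReal ((∑ p, z p) * x)))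
        ∂(Measure.pi fun _ : Position m => (volume : Measure ℝ).restrict (Ioi 0)) := by
  have hσ : ∀ ℓ, SigmaFinite (Measure.sum fun j : Fin (m ℓ) ↪ ℕ =>
      (Measure.dirac (X ∘ j)).prod (indexedRankingLaw w j)) := fun ℓ =>
    sigmaFinite_rankingLaw_atomicMeasure hw hsum hX (m ℓ)
  simp_rw [rankingLaw_atomicMeasure hw hsum hX]
  rw [pi_sum_eq (fun ℓ (j : Fin (m ℓ) ↪ ℕ) => (Measure.dirac (X ∘ j)).prod (indexedRankingLaw w j)),
    Measure.sum_apply _ hS, ← listsEquiv.tsum_eq, ENNReal.tsum_sigma']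
  congr 1 with s
  congr 1 with k
  set j := listsEquiv ⟨s, k⟩ with hj
  have hσ'' : ∀ ℓ, SigmaFinite ((indexedRankingLaw w (j ℓ)).map (Prod.mk (X ∘ j ℓ))) := fun ℓ => by
    rw [← Measure.dirac_prod]; infer_instance
  simp_rw [Measure.dirac_prod]
  rw [← Measure.pi_map_pi (fun ℓ => (measurable_prodMk_left).aemeasurable)]
  have h1 : Measure.pi (fun ℓ => indexedRankingLaw w (j ℓ))
      = (Measure.pi fun p : Position m => tiltedLebesgue (w (k (Quotient.mk s.1 p)))
        (sumOff w (listsOfClasses ⟨s, k⟩ p.1 '' Iio p.2) ENNReal.ofReal)).map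
          fun z ℓ i => z ⟨ℓ, i⟩ := by
    rw [← pi_pi_eq_map_curry]; rfl
  have hf : ∀ p : Position m, Measurable fun z : ℝ =>
      ENNReal.ofReal (w (k (Quotient.mk s.1 p))) *
      negExp (sumOff w (listsOfClasses ⟨s, k⟩ p.1 '' Iio p.2) ENNReal.ofReal * ENNReal.ofReal z) :=
    fun p => by fun_prop
  have hσ3 : ∀ p : Position m, SigmaFinite (((volume : Measure ℝ).restrict (Ioi 0)).withDensity
      fun z : ℝ => ENNReal.ofReal (w (k (Quotient.mk s.1 p))) *
      negExp (sumOff w (listsOfClasses ⟨s, k⟩ p.1 '' Iio p.2) ENNReal.ofReal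
        * ENNReal.ofReal z)) := fun p => inferInstanceAs (SigmaFinite (tiltedLebesgue _ _))
  have hmeas : Measurable fun z : Position m → ℝ => assemble s (X ∘ k, z) :=
    (measurable_assemble s).comp measurable_prodMk_left
  rw [h1, Measure.map_map (by fun_prop) (by fun_prop)]
  have h2 : ((fun (x : (ℓ : Fin L) → Fin (m ℓ) → ℝ) ℓ => (X ∘ j ℓ, x ℓ)) ∘
      fun (z : Position m → ℝ) ℓ i => z ⟨ℓ, i⟩) = fun z => assemble s (X ∘ k, z) := rfl
  rw [h2, Measure.map_apply hmeas hS]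
  simp only [tiltedLebesgue]
  rw [pi_withDensity_eq hf, withDensity_apply _ (hmeas hS), ← lintegral_indicator (hmeas hS)]
  refine lintegral_congr_ae ?_
  have hpos : ∀ᵐ z ∂(Measure.pi fun _ : Position m => (volume : Measure ℝ).restrict (Ioi 0)),
      ∀ p, 0 < z p := by
    rw [ae_all_iff]
    intro p
    exact Measure.tendsto_eval_ae_ae (i := p) (ae_restrict_mem measurableSet_Ioi)
  filter_upwards [hpos] with z hz
  rw [← prod_tiltedLebesgue_density hw s k hz]
  by_cases h : assemble s (X ∘ k, z) ∈ S
  · rw [indicator_of_mem (show z ∈ (fun z => assemble s (X ∘ k, z)) ⁻¹' S from h), indicator_of_mem h, Pi.one_apply, one_mul]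
  · rw [indicator_of_notMem (show z ∉ (fun z => assemble s (X ∘ k, z)) ⁻¹' S from h), indicator_of_notMem h, zero_mul]

end TiePatterns

/-! ### The claimed density, tie pattern by tie pattern. -/

section JointDensity

variable {L : ℕ} {m : Fin L → ℕ} {𝕏 : Type*}

/-- Injectivity of `x` makes two positions hold the same item exactly when they lie in the same
class. -/
lemma jointDensity_assemble (α τ : ℝ) (h : 𝕏 → ℝ) (s : TiePattern m) [Fintype (Quotient s.1)]
    {x : Quotient s.1 → 𝕏} (hx : Function.Injective x) (z : Position m → ℝ) :
    jointDensity α τ h (assemble s (x, z))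
      = Real.exp (-laplaceExponent α τ (∑ p, z p)) *
        ∏ q, h (x q) * tiltedMoment α τ (classCount s q) (classExposure s q z) := by
  classical
  have e1 : uniqueItems (assemble s (x, z)) = Finset.univ.image x := by
    ext y
    simp only [uniqueItems, assemble, Finset.mem_image, Finset.mem_univ, true_and]
    constructor
    · rintro ⟨p, rfl⟩
      exact ⟨_, rfl⟩
    · rintro ⟨q, rfl⟩
      obtain ⟨p, rfl⟩ := Quotient.exists_rep q
      exact ⟨p, rfl⟩
  have e2 : ∀ q, occurrences (assemble s (x, z)) (x q) = classCount s q := by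
    intro q
    simp only [occurrences, classCount, assemble, hx.eq_iff]
  have e3 : ∀ q, ∑ ℓ, ∑ i, occurrenceIndicator (assemble s (x, z)) ℓ i (x q)
      * (assemble s (x, z) ℓ).2 i = classExposure s q z := by
    intro q
    simp only [classExposure, Fintype.sum_sigma, occurrenceIndicator, classIndicator, assemble,
      hx.eq_iff]
  rw [jointDensity, e1, Finset.prod_image fun _ _ _ _ h => hx h]
  simp_rw [e2, e3]
  rw [Fintype.sum_sigma]
  rfl

lemma measurable_laplaceExponent (α τ : ℝ) : Measurable (laplaceExponent α τ) := by
  have : Measurable (Function.uncurry fun z w : ℝ =>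
      levyIntensity α τ w * (1 - Real.exp (-(z * w)))) := by
    have := measurable_levyIntensity α τ
    unfold Function.uncurry
    fun_prop
  exact (this.stronglyMeasurable.integral_prod_right
    (ν := (volume : Measure ℝ).restrict (Ioi 0))).measurable

lemma measurable_tiltedMoment (α τ : ℝ) (n : ℕ) : Measurable (tiltedMoment α τ n) := by
  have : Measurable (Function.uncurry fun z w : ℝ =>
      levyIntensity α τ w * w ^ n * Real.exp (-(z * w))) := by
    have := measurable_levyIntensity α τ
    unfold Function.uncurry
    fun_prop
  exact (this.stronglyMeasurable.integral_prod_right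
    (ν := (volume : Measure ℝ).restrict (Ioi 0))).measurable

@[fun_prop]
lemma measurable_classExposure (s : TiePattern m) (q : Quotient s.1) :
    Measurable (classExposure s q) := by
  unfold classExposure; fun_prop

variable [MeasurableSpace 𝕏] [MeasurableEq 𝕏]

/-- The range is cut out by finitely many equations between items, measurable because the diagonal
is. Integrals can then be pulled back along `assemble` without measurability of `jointDensity` on
the data space. -/
lemma measurableEmbedding_assemble (s : TiePattern m) :
    MeasurableEmbedding (assemble (𝕏 := 𝕏) s) := by
  have hr : range (assemble (𝕏 := 𝕏) s) = ⋂ (p : Position m) (q : Position m)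
      (_ : s.1.r p q), {d : RankingData 𝕏 m | (d p.1).1 p.2 = (d q.1).1 q.2} := by
    ext d
    simp only [mem_range, mem_iInter, mem_ofPred_eq]
    constructor
    · rintro ⟨⟨x, z⟩, rfl⟩ p q hpq
      exact congrArg x (Quotient.sound hpq)
    · intro hd
      exact ⟨⟨Quotient.lift (fun p : Position m => (d p.1).1 p.2) hd, fun p => (d p.1).2 p.2⟩, rfl⟩
  refine MeasurableEmbedding.of_measurable_inverse (measurable_assemble s) ?_
    (g := fun d => (fun q => (d q.out.1).1 q.out.2, fun p => (d p.1).2 p.2)) ?_ ?_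
  · rw [hr]
    refine MeasurableSet.iInter fun p => MeasurableSet.iInter fun q => MeasurableSet.iInter fun _ =>
      measurableSet_eq_fun ?_ ?_ <;> fun_prop
  · fun_prop
  · rintro ⟨x, z⟩
    simp only [assemble, Prod.mk.injEq, and_true]
    ext q
    exact congrArg x q.out_eq

lemma measurableSet_injective {ι : Type*} [Countable ι] :
    MeasurableSet {x : ι → 𝕏 | Function.Injective x} := by
  have : {x : ι → 𝕏 | Function.Injective x} = ⋂ (i : ι) (j : ι) (_ : i ≠ j),
      {x : ι → 𝕏 | x i = x j}ᶜ := by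
    ext x
    simp only [mem_ofPred_eq, mem_iInter, mem_compl_iff]
    exact ⟨fun h i j hij => h.ne hij, fun h i j hij => by_contra fun hne => h i j hne hij⟩
  rw [this]
  refine MeasurableSet.iInter fun i => MeasurableSet.iInter fun j => MeasurableSet.iInter fun _ =>
    (measurableSet_eq_fun ?_ ?_).compl <;> fun_prop

-- Puts the target in the form that averaging the conditional law produces: for each tie pattern, a
-- location factor times a mass factor.
open Classical in
lemma withDensity_referenceMeasure_apply {α τ : ℝ} (hα : 0 < α) (hτ : 0 < τ) (μ : Measure 𝕏)
    [SigmaFinite μ] {h : 𝕏 → ℝ} (h_meas : Measurable h) (h_nonneg : ∀ x, 0 ≤ h x)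
    {S : Set (RankingData 𝕏 m)} (hS : MeasurableSet S) :
    (referenceMeasure μ m).withDensity (fun d => ENNReal.ofReal (jointDensity α τ h d)) S
      = ∑' s : TiePattern m,
        ∫⁻ z, (∫⁻ x in {x | Function.Injective x}, S.indicator 1 (assemble s (x, z)) *
            ∏ q, ENNReal.ofReal (h (x q)) ∂(Measure.pi fun _ : Quotient s.1 => μ)) *
          (ENNReal.ofReal (Real.exp (-laplaceExponent α τ (∑ p, z p))) *
            ∏ q, ENNReal.ofReal (tiltedMoment α τ (classCount s q) (classExposure s q z)))
        ∂(Measure.pi fun _ : Position m => (volume : Measure ℝ).restrict (Ioi 0)) := by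
  rw [withDensity_apply _ hS, referenceMeasure, ← lintegral_indicator hS,
    lintegral_sum_measure]
  congr 1 with s
  set η := Measure.pi fun _ : Position m => (volume : Measure ℝ).restrict (Ioi 0) with hη
  set ρ := (Measure.pi fun _ : Quotient s.1 => μ).restrict {x | Function.Injective x} with hρ
  have hψ := measurable_laplaceExponent α τ
  have hκ := measurable_tiltedMoment α τ
  have hB : Measurable fun z : Position m → ℝ =>
      ENNReal.ofReal (Real.exp (-laplaceExponent α τ (∑ p, z p))) *
        ∏ q, ENNReal.ofReal (tiltedMoment α τ (classCount s q) (classExposure s q z)) := by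
    refine Measurable.mul ?_ (Finset.measurable_prod _ fun q _ => ?_)
    · exact (Real.measurable_exp.comp (hψ.comp (by fun_prop)).neg).ennreal_ofReal
    · exact ((hκ _).comp (measurable_classExposure s q)).ennreal_ofReal
  have hA : Measurable fun p : (Quotient s.1 → 𝕏) × (Position m → ℝ) =>
      S.indicator (1 : RankingData 𝕏 m → ℝ≥0∞) (assemble s p) * ∏ q, ENNReal.ofReal (h (p.1 q)) := by
    refine Measurable.mul ((measurable_one.indicator hS).comp (measurable_assemble s)) ?_
    fun_prop
  rw [(measurableEmbedding_assemble s).lintegral_map]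
  have hinj : ∀ᵐ p ∂(ρ.prod η), Function.Injective p.1 :=
    Measure.quasiMeasurePreserving_fst.ae (ae_restrict_mem measurableSet_injective)
  have hpos : ∀ᵐ p ∂(ρ.prod η), ∀ i, 0 < p.2 i := by
    refine Measure.quasiMeasurePreserving_snd.ae (p := fun z : Position m → ℝ => ∀ i, 0 < z i) ?_
    rw [ae_all_iff]
    intro p
    exact Measure.tendsto_eval_ae_ae (i := p) (ae_restrict_mem measurableSet_Ioi)
  have hcongr : ∫⁻ p, S.indicator (fun d => ENNReal.ofReal (jointDensity α τ h d)) (assemble s p)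
        ∂(ρ.prod η)
      = ∫⁻ p, (S.indicator 1 (assemble s p) * ∏ q, ENNReal.ofReal (h (p.1 q))) *
          (ENNReal.ofReal (Real.exp (-laplaceExponent α τ (∑ i, p.2 i))) *
            ∏ q, ENNReal.ofReal (tiltedMoment α τ (classCount s q) (classExposure s q p.2)))
        ∂(ρ.prod η) := by
    refine lintegral_congr_ae ?_
    filter_upwards [hinj, hpos] with p hp hz
    by_cases hpS : assemble s p ∈ S
    · have hκ0 : ∀ q, 0 ≤ tiltedMoment α τ (classCount s q) (classExposure s q p.2) := fun q =>
        tiltedMoment_nonneg hα hτ (classCount_pos s q)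
          (classExposure_nonneg s q fun i => (hz i).le)
      rw [indicator_of_mem hpS, indicator_of_mem hpS, jointDensity_assemble α τ h s hp p.2,
        ENNReal.ofReal_mul (Real.exp_nonneg _),
        ENNReal.ofReal_prod_of_nonneg fun q _ => mul_nonneg (h_nonneg _) (hκ0 q)]
      simp_rw [ENNReal.ofReal_mul (h_nonneg _)]
      rw [Finset.prod_mul_distrib, Pi.one_apply]
      ring
    · rw [indicator_of_notMem hpS, indicator_of_notMem hpS, zero_mul, zero_mul]
  have hAB : Measurable fun p : (Quotient s.1 → 𝕏) × (Position m → ℝ) =>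
      (S.indicator (1 : RankingData 𝕏 m → ℝ≥0∞) (assemble s p) * ∏ q, ENNReal.ofReal (h (p.1 q))) *
          (ENNReal.ofReal (Real.exp (-laplaceExponent α τ (∑ i, p.2 i))) *
            ∏ q, ENNReal.ofReal (tiltedMoment α τ (classCount s q) (classExposure s q p.2))) :=
    hA.mul (hB.comp measurable_snd)
  refine hcongr.trans ((lintegral_prod_symm' _ hAB).trans (lintegral_congr fun z => ?_))
  have hAz : Measurable fun x : Quotient s.1 → 𝕏 =>
      S.indicator (1 : RankingData 𝕏 m → ℝ≥0∞) (assemble s (x, z)) * ∏ q, ENNReal.ofReal (h (x q)) :=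
    hA.comp measurable_prodMk_right
  exact lintegral_mul_const (μ := ρ)
    (ENNReal.ofReal (Real.exp (-laplaceExponent α τ (∑ p, z p))) *
      ∏ q, ENNReal.ofReal (tiltedMoment α τ (classCount s q) (classExposure s q z))) hAz

end JointDensity

/-! ### Averaging over masses and locations. -/

section Probability

variable {Ω : Type*} [MeasurableSpace Ω] {P : Measure Ω}

/-- Campbell's formula. -/
lemma IsPoissonProcess.lintegral_tsum [IsProbabilityMeasure P] {E : Type*} [MeasurableSpace E]
    {ν : Measure E} {w : ℕ → Ω → E} (hw : IsPoissonProcess P ν w) {g : E → ℝ≥0∞}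
    (hg : Measurable g) (hg' : ∀ x, g x ≠ ∞) :
    ∫⁻ ω, ∑' j, g (w j ω) ∂P = ∫⁻ x, g x ∂ν := by
  -- The differentiation step at `φ = 0`, with no index removed and trivial weight.
  have := lintegral_tsum_mul_sumOff (ι := Unit) (P := P) (ν := ν) hw.measurable
    (fun _ _ => 1) (fun _ => measurable_const) (fun _ => ∅) 1 ENNReal.one_ne_top
    (fun φ hφ _ => by simpa [sumOff] using hw.lintegral_negExp_tsum hφ)
    (φ := fun _ => 0) (g := g) measurable_const (by simp) hg hg'
  simpa [sumOff] using this

variable {α τ : ℝ} {w : ℕ → Ω → ℝ}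

/-- By Campbell's formula the expected number of points in `(-∞, 0]` is zero. -/
lemma IsPoissonProcess.ae_pos [IsProbabilityMeasure P]
    (hw : IsPoissonProcess P (levyMeasure α τ) w) : ∀ᵐ ω ∂P, ∀ j, 0 < w j ω := by
  have hm : Measurable ((Iic (0 : ℝ)).indicator (1 : ℝ → ℝ≥0∞)) :=
    measurable_one.indicator measurableSet_Iic
  have h := hw.lintegral_tsum hm
    (fun x => by by_cases hx : x ∈ Iic (0 : ℝ) <;> simp [indicator, hx])
  have hm' : ∀ j, Measurable fun ω => (Iic (0 : ℝ)).indicator (1 : ℝ → ℝ≥0∞) (w j ω) := fun j =>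
    hm.comp (hw.measurable j)
  rw [lintegral_indicator_one measurableSet_Iic, levyMeasure_Iic,
    lintegral_eq_zero_iff (Measurable.tsum hm')] at h
  filter_upwards [h] with ω hω j
  have := ENNReal.tsum_eq_zero.1 hω j
  by_contra hcon
  simp [indicator, not_lt.1 hcon] at this

/-- By Campbell's formula the mean total mass is `κ(1, 0)`, which is finite. -/
lemma IsPoissonProcess.ae_tsum_ne_top [IsProbabilityMeasure P] (hα : 0 < α) (hτ : 0 < τ)
    (hw : IsPoissonProcess P (levyMeasure α τ) w) :
    ∀ᵐ ω ∂P, ∑' j, ENNReal.ofReal (w j ω) ≠ ∞ := by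
  have h := hw.lintegral_tsum ENNReal.measurable_ofReal fun _ => ENNReal.ofReal_ne_top
  have h2 := lintegral_levyMeasure_tilted hα hτ (n := 1) (z := 0) le_rfl le_rfl
  simp only [pow_one, zero_mul, neg_zero, Real.exp_zero, mul_one] at h2
  rw [h2] at h
  filter_upwards [ae_lt_top (Measurable.tsum fun j => (hw.measurable j).ennreal_ofReal)
    (h.trans_ne ENNReal.ofReal_ne_top)] with ω hω
  exact hω.ne

variable {𝕏 : Type*} [MeasurableSpace 𝕏] {H : Measure 𝕏} {X : ℕ → Ω → 𝕏}

lemma map_comp_embedding_eq_pi {I : Type*} [Fintype I] (hX : ∀ j, Measurable (X j))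
    (hlaw : ∀ j, HasLaw (X j) H P) (hind : iIndepFun X P) (k : I ↪ ℕ) :
    P.map (fun ω q => X (k q) ω) = Measure.pi fun _ : I => H := by
  have : IsProbabilityMeasure P := hind.isProbabilityMeasure
  have h := (iIndepFun_iff_map_fun_eq_pi_map (fun q : I => (hX (k q)).aemeasurable)).1
    (hind.precomp k.injective)
  rw [h]
  congr 1 with q
  rw [(hlaw (k q)).map_eq]

/-- The diagonal is null for `H ⊗ H` since its fibres are points, and there are countably many pairs
of indices. -/
lemma ae_injective_of_iIndepFun [MeasurableEq 𝕏] [IsProbabilityMeasure H]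
    (hH : ∀ x, H {x} = 0) (hX : ∀ j, Measurable (X j))
    (hlaw : ∀ j, HasLaw (X j) H P) (hind : iIndepFun X P) :
    ∀ᵐ ω ∂P, Function.Injective fun j => X j ω := by
  have : IsProbabilityMeasure P := hind.isProbabilityMeasure
  have key : ∀ i j, i ≠ j → ∀ᵐ ω ∂P, X i ω ≠ X j ω := by
    intro i j hij
    have h := (indepFun_iff_map_prod_eq_prod_map_map (hX i).aemeasurable
      (hX j).aemeasurable).1 (hind.indepFun hij)
    rw [(hlaw i).map_eq, (hlaw j).map_eq] at h
    have h0 : (H.prod H) (diagonal 𝕏) = 0 := by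
      rw [Measure.measure_prod_null measurableSet_diagonal]
      refine .of_forall fun x => ?_
      have : Prod.mk x ⁻¹' diagonal 𝕏 = {x} := by ext y; simp [eq_comm]
      simp only [this, hH x, Pi.zero_apply]
    rw [← h, Measure.map_apply ((hX i).prodMk (hX j)) measurableSet_diagonal] at h0
    rw [ae_iff]
    convert! h0 using 2
    ext ω; simp
  have : ∀ᵐ ω ∂P, ∀ i j, i ≠ j → X i ω ≠ X j ω := by
    simp_rw [ae_all_iff]
    exact key
  filter_upwards [this] with ω hω i j hij
  by_contra hne
  exact hω i j hne hij

/-- The reference measure sees only pairwise distinct items; for the law of the locations that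
restriction costs nothing. -/
lemma pi_eq_restrict_injective [MeasurableEq 𝕏] [IsProbabilityMeasure H] {I : Type*} [Fintype I]
    (hH : ∀ x, H {x} = 0) (hX : ∀ j, Measurable (X j))
    (hlaw : ∀ j, HasLaw (X j) H P) (hind : iIndepFun X P) :
    (Measure.pi fun _ : I => H).restrict {x | Function.Injective x} = Measure.pi fun _ : I => H := by
  refine Measure.restrict_eq_self_of_ae_mem ?_
  obtain ⟨k⟩ : Nonempty (I ↪ ℕ) := ⟨(Fintype.equivFin I).toEmbedding.trans Fin.valEmbedding⟩
  change ∀ᵐ x ∂(Measure.pi fun _ : I => H), Function.Injective x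
  rw [← map_comp_embedding_eq_pi hX hlaw hind k, ae_map_iff (p := Function.Injective)
    (measurable_pi_lambda _ fun q => hX (k q)).aemeasurable measurableSet_injective]
  filter_upwards [ae_injective_of_iIndepFun hH hX hlaw hind] with ω hω
  exact hω.comp k.injective

lemma lintegral_pi_density [MeasurableEq 𝕏] {μ : Measure 𝕏} [SigmaFinite μ]
    [IsProbabilityMeasure H] {I : Type*} [Fintype I]
    (hH : ∀ x, H {x} = 0) (hX : ∀ j, Measurable (X j))
    (hlaw : ∀ j, HasLaw (X j) H P) (hind : iIndepFun X P)
    {h : 𝕏 → ℝ} (h_meas : Measurable h) (hHμ : H = μ.withDensity fun x => ENNReal.ofReal (h x))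
    {f : (I → 𝕏) → ℝ≥0∞} (hf : Measurable f) :
    ∫⁻ x, f x ∂(Measure.pi fun _ : I => H)
      = ∫⁻ x in {x | Function.Injective x}, f x * ∏ q, ENNReal.ofReal (h (x q))
        ∂(Measure.pi fun _ : I => μ) := by
  have hσ : ∀ _ : I, SigmaFinite (μ.withDensity fun x => ENNReal.ofReal (h x)) := fun _ => by
    rw [← hHμ]; infer_instance
  have hpi : (Measure.pi fun _ : I => H)
      = (Measure.pi fun _ : I => μ).withDensity fun x => ∏ q, ENNReal.ofReal (h (x q)) := by
    rw [← pi_withDensity_eq (fun _ => h_meas.ennreal_ofReal), hHμ]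
  rw [← pi_eq_restrict_injective hH hX hlaw hind, hpi, restrict_withDensity measurableSet_injective,
    lintegral_withDensity_eq_lintegral_mul _ (by fun_prop) hf]
  simp_rw [Pi.mul_apply, mul_comm]

variable {L : ℕ} {m : Fin L → ℕ}

/-- The contribution of the masses to the density of the data when the classes of ties have the
indices `k`. -/
noncomputable def classWeight (s : TiePattern m) [Fintype (Quotient s.1)] (k : Quotient s.1 ↪ ℕ)
    (z : Position m → ℝ) (v : ℕ → ℝ) : ℝ≥0∞ :=
  (∏ q, ENNReal.ofReal (v (k q) ^ classCount s q *
    Real.exp (-(classExposure s q z * v (k q)))))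
    * negExp (sumOff v (range k) fun x => ENNReal.ofReal ((∑ p, z p) * x))

lemma measurable_classWeight (s : TiePattern m) [Fintype (Quotient s.1)] (k : Quotient s.1 ↪ ℕ) :
    Measurable (Function.uncurry (classWeight s k)) := by
  unfold classWeight Function.uncurry
  refine Measurable.mul (Finset.measurable_prod _ fun q _ => ?_) (measurable_negExp.comp ?_)
  · have := measurable_classExposure s q
    fun_prop
  · unfold sumOff
    refine Measurable.tsum fun i => ?_
    by_cases hi : i ∈ (range k)ᶜ
    · simp only [indicator_of_mem hi]; fun_prop
    · simp only [indicator_of_notMem hi]; fun_prop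

lemma measurable_classWeight_comp (s : TiePattern m) [Fintype (Quotient s.1)]
    (k : Quotient s.1 ↪ ℕ) {β : Type*} [MeasurableSpace β] {f : β → Position m → ℝ}
    {g : β → ℕ → ℝ} (hf : Measurable f) (hg : Measurable g) :
    Measurable fun b => classWeight s k (f b) (g b) := by
  have h := (measurable_classWeight s k).comp (hf.prodMk hg)
  exact h

/-- The Mecke formula with one distinguished point per class and `φ(x) = x ∑ z`: each class integral
is a `κ`, and the exponent is `ψ(∑ z)`. -/
lemma lintegral_tsum_classWeight [IsProbabilityMeasure P] (hα : 0 < α) (hτ : 0 < τ)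
    (hw : IsPoissonProcess P (levyMeasure α τ) w) (s : TiePattern m) [Fintype (Quotient s.1)]
    {z : Position m → ℝ} (hz : ∀ p, 0 ≤ z p) :
    ∫⁻ ω, ∑' k : Quotient s.1 ↪ ℕ, classWeight s k z (fun j => w j ω) ∂P
      = ENNReal.ofReal (Real.exp (-laplaceExponent α τ (∑ p, z p))) *
        ∏ q, ENNReal.ofReal (tiltedMoment α τ (classCount s q) (classExposure s q z)) := by
  have hZ : 0 ≤ ∑ p, z p := Finset.sum_nonneg fun p _ => hz p
  have hc := fun q => lintegral_levyMeasure_tilted hα hτ (classCount_pos s q)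
    (classExposure_nonneg s q hz)
  have := hw.lintegral_tsum_embedding (Quotient s.1)
    (fun q x => ENNReal.ofReal (x ^ classCount s q * Real.exp (-(classExposure s q z * x))))
    (fun q => by fun_prop) (fun _ _ => ENNReal.ofReal_ne_top)
    (fun q => (hc q).trans_ne ENNReal.ofReal_ne_top)
    (fun x => ENNReal.ofReal ((∑ p, z p) * x)) (by fun_prop) fun _ => ENNReal.ofReal_ne_top
  simp_rw [classWeight, this, hc]
  rw [lintegral_levyMeasure_one_sub hα hτ hZ, negExp_ofReal (laplaceExponent_nonneg hα hτ hZ)]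

lemma measurable_indicator_assemble {S : Set (RankingData 𝕏 m)} (hS : MeasurableSet S)
    (s : TiePattern m) {β : Type*} [MeasurableSpace β]
    {f : β → (Quotient s.1 → 𝕏) × (Position m → ℝ)} (hf : Measurable f) :
    Measurable fun b => S.indicator (1 : RankingData 𝕏 m → ℝ≥0∞) (assemble s (f b)) := by
  have h1 : Measurable fun b => assemble s (f b) := (measurable_assemble s).comp hf
  exact (measurable_one.indicator hS).comp h1

open Classical in
theorem map_eq_withDensity_referenceMeasure [MeasurableEq 𝕏] [IsProbabilityMeasure P]
    (hα : 0 < α) (hτ : 0 < τ) (μ : Measure 𝕏) [SigmaFinite μ]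
    {h : 𝕏 → ℝ} (h_meas : Measurable h) (h_nonneg : ∀ x, 0 ≤ h x)
    [IsProbabilityMeasure H] (hH : ∀ x, H {x} = 0)
    (hHμ : H = μ.withDensity fun x => ENNReal.ofReal (h x))
    {G : Ω → Measure 𝕏} (hG : IsGammaProcess P α τ H G) {D : Ω → RankingData 𝕏 m}
    (hD : IsPlackettLuceSample P G m D) :
    P.map D = (referenceMeasure μ m).withDensity
      fun d => ENNReal.ofReal (jointDensity α τ h d) := by
  obtain ⟨-, w, X, hw, hX, hlaw, hind, hXw, hGe⟩ := hG
  obtain ⟨hDm, hDl⟩ := hD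
  ext S hS
  rw [withDensity_referenceMeasure_apply hα hτ μ h_meas h_nonneg hS, Measure.map_apply hDm hS]
  -- Conditioning on the trivial event gives the unconditional law of the data.
  have h0 := hDl univ S .univ hS
  rw [preimage_univ, univ_inter, Measure.restrict_univ] at h0
  rw [h0]
  set η := Measure.pi fun _ : Position m => (volume : Measure ℝ).restrict (Ioi 0) with hη
  have hXm : ∀ {I : Type} (k : I ↪ ℕ), Measurable fun ω (q : I) => X (k q) ω := fun k =>
    measurable_pi_lambda _ fun q => hX (k q)
  have hwm : Measurable fun ω j => w j ω := measurable_pi_lambda _ hw.measurable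
  have hmeasW : ∀ (s : TiePattern m) (k : Quotient s.1 ↪ ℕ),
      Measurable fun p : Ω × (Position m → ℝ) => classWeight s k p.2 (fun j => w j p.1) :=
    fun s k => measurable_classWeight_comp s k measurable_snd (hwm.comp measurable_fst)
  have hmeas : ∀ (s : TiePattern m) (k : Quotient s.1 ↪ ℕ),
      Measurable fun p : Ω × (Position m → ℝ) =>
        S.indicator (1 : RankingData 𝕏 m → ℝ≥0∞) (assemble s (fun q => X (k q) p.1, p.2)) *
          classWeight s k p.2 (fun j => w j p.1) := by
    intro s k
    have h1 : Measurable fun p : Ω × (Position m → ℝ) =>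
        ((fun q => X (k q) p.1 : Quotient s.1 → 𝕏), p.2) :=
      ((hXm k).comp measurable_fst).prodMk measurable_snd
    exact (measurable_indicator_assemble hS s h1).mul (hmeasW s k)
  have e1 : ∫⁻ ω, Measure.pi (fun ℓ => rankingLaw (G ω) (m ℓ)) S ∂P
      = ∫⁻ ω, ∑' s : TiePattern m, ∑' k : Quotient s.1 ↪ ℕ,
        ∫⁻ z, S.indicator (1 : RankingData 𝕏 m → ℝ≥0∞) (assemble s (fun q => X (k q) ω, z)) *
          classWeight s k z (fun j => w j ω) ∂η ∂P := by
    refine lintegral_congr_ae ?_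
    filter_upwards [hGe, hw.ae_pos, hw.ae_tsum_ne_top hα hτ,
      ae_injective_of_iIndepFun hH hX hlaw hind] with ω h1 h2 h3 h4
    rw [h1]
    exact pi_rankingLaw_atomicMeasure h2 h3 h4 hS
  rw [e1, lintegral_tsum fun s => (Measurable.tsum fun k =>
    (hmeas s k).lintegral_prod_right').aemeasurable]
  congr 1 with s
  rw [lintegral_tsum fun k => (hmeas s k).lintegral_prod_right'.aemeasurable]
  -- For fixed indices `k`, independence of locations and masses splits the expectation. The
  -- location factor does not depend on `k`, so the sum over `k` acts on the masses alone.
  have e2 : ∀ k : Quotient s.1 ↪ ℕ, ∫⁻ ω, ∫⁻ z,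
        S.indicator (1 : RankingData 𝕏 m → ℝ≥0∞) (assemble s (fun q => X (k q) ω, z)) *
          classWeight s k z (fun j => w j ω) ∂η ∂P
      = ∫⁻ z, (∫⁻ x, S.indicator (1 : RankingData 𝕏 m → ℝ≥0∞) (assemble s (x, z))
          ∂(Measure.pi fun _ : Quotient s.1 => H)) *
          ∫⁻ ω, classWeight s k z (fun j => w j ω) ∂P ∂η := by
    intro k
    rw [lintegral_lintegral_swap (hmeas s k).aemeasurable]
    congr 1 with z
    have hf : Measurable fun x : Quotient s.1 → 𝕏 =>
        S.indicator (1 : RankingData 𝕏 m → ℝ≥0∞) (assemble s (x, z)) :=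
      measurable_indicator_assemble hS s measurable_prodMk_right
    have hg : Measurable (classWeight s k z) :=
      (measurable_classWeight s k).of_uncurry_left
    have hXm' : Measurable fun ω j => X j ω := measurable_pi_lambda _ hX
    have hk : Measurable fun (x : ℕ → 𝕏) (q : Quotient s.1) => x (k q) :=
      measurable_pi_lambda _ fun q => measurable_pi_apply _
    have hf' := hf.comp hk
    rw [← map_comp_embedding_eq_pi hX hlaw hind k, lintegral_map hf (hXm k)]
    exact lintegral_mul_eq_lintegral_mul_lintegral_of_indepFun''
      (hf'.comp hXm').aemeasurable (hg.comp hwm).aemeasurable (hXw.comp hf' hg)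
  simp_rw [e2]
  have hmeasH : Measurable fun z : Position m → ℝ =>
      ∫⁻ x, S.indicator (1 : RankingData 𝕏 m → ℝ≥0∞) (assemble s (x, z))
          ∂(Measure.pi fun _ : Quotient s.1 => H) :=
    (measurable_indicator_assemble hS s measurable_id).lintegral_prod_left'
  have hmeasW' : ∀ k : Quotient s.1 ↪ ℕ, Measurable fun z : Position m → ℝ =>
      ∫⁻ ω, classWeight s k z (fun j => w j ω) ∂P := fun k => (hmeasW s k).lintegral_prod_left'
  have hmeasW'' : ∀ (k : Quotient s.1 ↪ ℕ) (z : Position m → ℝ), Measurable fun ω =>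
      classWeight s k z (fun j => w j ω) := fun k z =>
    measurable_classWeight_comp s k measurable_const hwm
  have hmeasHW : ∀ k : Quotient s.1 ↪ ℕ, Measurable fun z : Position m → ℝ =>
      (∫⁻ x, S.indicator (1 : RankingData 𝕏 m → ℝ≥0∞) (assemble s (x, z))
        ∂(Measure.pi fun _ : Quotient s.1 => H)) * ∫⁻ ω, classWeight s k z (fun j => w j ω) ∂P :=
    fun k => hmeasH.mul (hmeasW' k)
  rw [← lintegral_tsum fun k => (hmeasHW k).aemeasurable]
  refine lintegral_congr_ae ?_
  have hpos : ∀ᵐ z ∂η, ∀ p, 0 < z p := by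
    rw [ae_all_iff]
    intro p
    exact Measure.tendsto_eval_ae_ae (i := p) (ae_restrict_mem measurableSet_Ioi)
  filter_upwards [hpos] with z hz
  rw [ENNReal.tsum_mul_left, ← lintegral_tsum fun k => (hmeasW'' k z).aemeasurable,
    lintegral_tsum_classWeight hα hτ hw s fun p => (hz p).le,
    lintegral_pi_density hH hX hlaw hind h_meas hHμ
      (measurable_indicator_assemble hS s measurable_prodMk_right)]

end Probability

end PlackettLuce

/-! ### The main theorem. -/

theorem theorem1 {Ω 𝕏 : Type*} [MeasurableSpace Ω] [MeasurableSpace 𝕏] [MeasurableEq 𝕏]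
    (P : Measure Ω) [IsProbabilityMeasure P]
    (α τ : ℝ) (hα : 0 < α) (hτ : 0 < τ)
    (μ : Measure 𝕏) [SigmaFinite μ]
    (h : 𝕏 → ℝ) (h_meas : Measurable h) (h_nonneg : ∀ x, 0 ≤ h x)
    (H : Measure 𝕏) [IsProbabilityMeasure H] (hH_nonatomic : ∀ x, H {x} = 0)
    (hH : H = μ.withDensity fun x => ENNReal.ofReal (h x))
    (G : Ω → Measure 𝕏) (hG : PlackettLuce.IsGammaProcess P α τ H G)
    (L : ℕ) (m : Fin L → ℕ) (D : Ω → PlackettLuce.RankingData 𝕏 m)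
    (hD : PlackettLuce.IsPlackettLuceSample P G m D) :
    P.map D = (PlackettLuce.referenceMeasure μ m).withDensity
        (fun d => ENNReal.ofReal (PlackettLuce.jointDensity α τ h d)) ∧
    (∀ᵐ ω ∂P, G ω univ < ∞) ∧
    (∀ z : ℝ, 0 ≤ z →
      Integrable (fun ω => Real.exp (-(z * (G ω univ).toReal))) P ∧
      IntegrableOn (fun w => PlackettLuce.levyIntensity α τ w * (1 - Real.exp (-(z * w)))) (Ioi 0) ∧
      PlackettLuce.laplaceExponent α τ z
        = -Real.log (∫ ω, Real.exp (-(z * (G ω univ).toReal)) ∂P) ∧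
      PlackettLuce.laplaceExponent α τ z = α * Real.log (1 + z / τ)) ∧
    (∀ (n : ℕ) (z : ℝ), 1 ≤ n → 0 ≤ z →
      IntegrableOn
        (fun w => PlackettLuce.levyIntensity α τ w * w ^ n * Real.exp (-(z * w))) (Ioi 0) ∧
      PlackettLuce.tiltedMoment α τ n z = α / (z + τ) ^ n * Real.Gamma n) := by
  refine ⟨PlackettLuce.map_eq_withDensity_referenceMeasure hα hτ μ h_meas h_nonneg hH_nonatomic hH
    hG hD, ?_, fun z hz => ?_, fun n z hn hz =>
    ⟨PlackettLuce.integrableOn_tiltedIntensity hτ hn hz, PlackettLuce.tiltedMoment_eq hτ hn hz⟩⟩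
  · obtain ⟨-, w, X, hw, -, -, -, -, hGe⟩ := hG
    filter_upwards [hGe, hw.ae_tsum_ne_top hα hτ] with ω h1 h2
    rw [h1]
    exact (PlackettLuce.atomicMeasure_univ (X := fun j => X j ω)).trans_lt h2.lt_top
  · obtain ⟨hGm, w, X, hw, -, -, -, -, hGe⟩ := hG
    have hm : Measurable fun ω => Real.exp (-(z * (G ω univ).toReal)) := by
      have : Measurable fun ω => G ω univ := (Measure.measurable_coe .univ).comp hGm
      fun_prop
    refine ⟨?_, PlackettLuce.integrableOn_laplaceIntegrand hα hτ hz, ?_,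
      PlackettLuce.laplaceExponent_eq hα hτ hz⟩
    · refine Integrable.of_bound hm.aestronglyMeasurable 1 (.of_forall fun ω => ?_)
      rw [Real.norm_of_nonneg (Real.exp_nonneg _), Real.exp_le_one_iff]
      have : 0 ≤ (G ω univ).toReal := ENNReal.toReal_nonneg
      nlinarith
    -- The Laplace functional at `φ(w) = z w`, whose sum over the points is `z` times the total
    -- mass.
    · have e : ∫⁻ ω, ENNReal.ofReal (Real.exp (-(z * (G ω univ).toReal))) ∂P
          = ENNReal.ofReal (Real.exp (-PlackettLuce.laplaceExponent α τ z)) := by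
        rw [← PlackettLuce.negExp_ofReal (PlackettLuce.laplaceExponent_nonneg hα hτ hz),
          ← PlackettLuce.lintegral_levyMeasure_one_sub hα hτ hz,
          ← hw.lintegral_negExp_tsum (by fun_prop)]
        refine lintegral_congr_ae ?_
        filter_upwards [hGe, hw.ae_tsum_ne_top hα hτ] with ω h1 h2
        have h3 : G ω univ = ∑' j, ENNReal.ofReal (w j ω) := by
          rw [h1]
          exact PlackettLuce.atomicMeasure_univ (X := fun j => X j ω)
        rw [h3, ← PlackettLuce.negExp_ofReal (mul_nonneg hz ENNReal.toReal_nonneg),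
          ENNReal.ofReal_mul hz, ENNReal.ofReal_toReal h2, ← ENNReal.tsum_mul_left]
        simp_rw [ENNReal.ofReal_mul hz]
      rw [integral_eq_lintegral_of_nonneg_ae (.of_forall fun ω => Real.exp_nonneg _)
        hm.aestronglyMeasurable, e, ENNReal.toReal_ofReal (Real.exp_nonneg _), Real.log_exp, neg_neg]
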